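/- Let $H$ be a complex separable Hilbert space with an orthogonal splitting $H=H_1\oplus H_2$ into closed subspaces, and let $P_1,P_2$ be the orthogonal projections onto $H_1,H_2$ and $J=P_1-P_2$. For a bounded operator $A$ on $H$ let $A_{ij}\colon H_j\to H_i$ ($i,j=1,2$) be its blocks, and put $A_{\mathrm{even}}=P_1AP_1+P_2AP_2$, $A_{\mathrm{odd}}=P_1AP_2+P_2AP_1$. Let $\mathscr L_{1|2}(H)$ be the set of bounded operators $A$ on $H$ such that $A_{\mathrm{even}}$ is trace class and $A_{\mathrm{odd}}$ is Hilbert--Schmidt. For a trace-class operator $B$ let $\operatorname{Det}(1+B)=1+\sum_{n\ge1}\operatorname{Tr}(\wedge^n B)$ be its Fredholm determinant, and for $A\in\mathscr L_{1|2}(H)$ let $$\operatorname{Det}(1+A)=\operatorname{Det}\big((1+A)e^{-A}\big)\cdot e^{\operatorname{Tr}(A_{\mathrm{even}})}$$ be the extended Fredholm determinant. Let $A\in\mathscr L_{1|2}(H)$ be $J$-self-adjoint, i.e. $(JAf,g)=(Jf,Ag)$ for all $f,g\in H$, and assume that $\|A\|<1$ (operator norm) and $A_{11}\ge0$. Then $1-A_{11}$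 is invertible in the algebra of bounded operators on $H_1$, the operators $A_{11}$ on $H_1$ and $A_{22}+A_{21}(1-A_{11})^{-1}A_{12}$ on $H_2$ are trace class, and $$\operatorname{Det}(1-A)=\operatorname{Det}(1-A_{11})\cdot\operatorname{Det}\big(1-A_{22}-A_{21}(1-A_{11})^{-1}A_{12}\big)>0,$$ where $\operatorname{Det}(1-A)$ is the extended Fredholm determinant and the two determinants on the right-hand side are classical Fredholm determinants on $H_1$ and $H_2$; in particular $\operatorname{Det}(1-A)$ is real. -/

import Mathlib

open scoped InnerProductSpace

noncomputable section

namespace ExtFredholm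

section General

variable (H : Type*) [NormedAddCommGroup H] [InnerProductSpace ℂ H] [CompleteSpace H]

/-- The index set of an orthonormal basis of `H`. -/
def BasisIndex : Set H := Classical.choose (exists_hilbertBasis ℂ H)

/-- A (fixed) orthonormal basis of the Hilbert space `H`. The notions below that use it
(trace class, trace, Hilbert-Schmidt) do not depend on which basis is taken. -/
def onb : HilbertBasis (BasisIndex H) ℂ H :=
  Classical.choose (Classical.choose_spec (exists_hilbertBasis ℂ H))

variable {H}

/-- `A` is trace class: `Tr |A| < ∞`, where `|A| = (A⋆ A)^{1/2}`. (The summands are nonnegative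
real numbers.) -/
def IsTraceClass (A : H →L[ℂ] H) : Prop :=
  Summable fun i : BasisIndex H => (⟪onb H i, CFC.abs A (onb H i)⟫_ℂ).re

/-- The trace of a trace class operator. -/
def trace (A : H →L[ℂ] H) : ℂ :=
  ∑' i : BasisIndex H, ⟪onb H i, A (onb H i)⟫_ℂ

/-- `A` is a Hilbert-Schmidt operator. -/
def IsHilbertSchmidt (A : H →L[ℂ] H) : Prop :=
  Summable fun i : BasisIndex H => ‖A (onb H i)‖ ^ 2

/-- The linear functional `⟪x₁ ∧ ⋯ ∧ xₙ, · ⟫` on the exterior power; its value at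
`y₁ ∧ ⋯ ∧ yₙ` is `det ⟪xᵢ, yⱼ⟫` (see `wedgeInner_ιMulti`). -/
def wedgeInner {n : ℕ} (x : Fin n → H) : ⋀[ℂ]^n H →ₗ[ℂ] ℂ :=
  exteriorPower.pairingDual ℂ H n
    (exteriorPower.ιMulti ℂ n fun k => ((innerSL ℂ (x k) : H →L[ℂ] ℂ) : H →ₗ[ℂ] ℂ))

theorem wedgeInner_ιMulti {n : ℕ} (x y : Fin n → H) :
    wedgeInner x (exteriorPower.ιMulti ℂ n y) =
      (Matrix.of fun i j : Fin n => ⟪x i, y j⟫_ℂ).det := by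
  rw [wedgeInner, exteriorPower.pairingDual_ιMulti_ιMulti, ← Matrix.det_transpose]
  rfl

/-- The vectors `e_{i₁}, …, e_{iₙ}` for an `n`-element set `s = {i₁, …, iₙ}` of indices, enumerated
in some order. The vectors `e_{i₁} ∧ ⋯ ∧ e_{iₙ}`, one for each `s`, form an orthonormal basis of the
`n`-th antisymmetric power of `H`. -/
def onbTuple (n : ℕ) (s : {s : Finset (BasisIndex H) // s.card = n}) : Fin n → H :=
  fun k => onb H ((s.1.equivFinOfCardEq s.2).symm k : s.1)

/-- `Tr (⋀ⁿ A)`: the sum of the diagonal matrix elements of `⋀ⁿ A` in the orthonormal basis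
`e_{i₁} ∧ ⋯ ∧ e_{iₙ}` of the `n`-th antisymmetric power of `H`. -/
def traceWedge (n : ℕ) (A : H →L[ℂ] H) : ℂ :=
  ∑' s : {s : Finset (BasisIndex H) // s.card = n},
    wedgeInner (onbTuple n s)
      (exteriorPower.map n (A : H →ₗ[ℂ] H) (exteriorPower.ιMulti ℂ n (onbTuple n s)))

theorem traceWedge_eq_tsum_det (n : ℕ) (A : H →L[ℂ] H) :
    traceWedge n A = ∑' s : {s : Finset (BasisIndex H) // s.card = n},
      (Matrix.of fun i j : Fin n => ⟪onbTuple n s i, A (onbTuple n s j)⟫_ℂ).det := by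
  refine tsum_congr fun s => ?_
  rw [exteriorPower.map_apply_ιMulti, wedgeInner_ιMulti]
  rfl

/-- The classical Fredholm determinant `Det T`, for `T` such that `T - 1` is trace class:
`Det (1 + B) = 1 + ∑_{n ≥ 1} Tr (⋀ⁿ B)`. -/
def fredholmDet (T : H →L[ℂ] H) : ℂ :=
  1 + ∑' n : ℕ, traceWedge (n + 1) (T - 1)

end General

section Splitting

variable {H : Type*} [NormedAddCommGroup H] [InnerProductSpace ℂ H] [CompleteSpace H]

/-- For closed subspaces `K`, `L` of `H`, the block `L → K` of the operator `A`. -/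
def block (K L : Submodule ℂ H) [CompleteSpace K] (A : H →L[ℂ] H) : L →L[ℂ] K :=
  K.orthogonalProjectionOnto ∘L A ∘L L.subtypeL

variable (H₁ : Submodule ℂ H) [CompleteSpace H₁]

/-- The block diagonal part `P₁ A P₁ + P₂ A P₂` of `A` for the splitting `H = H₁ ⊕ H₁ᗮ`. -/
def evenPart (A : H →L[ℂ] H) : H →L[ℂ] H :=
  H₁.starProjection * A * H₁.starProjection + H₁ᗮ.starProjection * A * H₁ᗮ.starProjection

/-- The off-diagonal part `P₁ A P₂ + P₂ A P₁` of `A` for the splitting `H = H₁ ⊕ H₁ᗮ`. -/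
def oddPart (A : H →L[ℂ] H) : H →L[ℂ] H :=
  H₁.starProjection * A * H₁ᗮ.starProjection + H₁ᗮ.starProjection * A * H₁.starProjection

/-- The class `𝓛_{1|2}(H)`: the even part is trace class, the odd part is Hilbert-Schmidt. -/
def IsL12 (A : H →L[ℂ] H) : Prop :=
  IsTraceClass (evenPart H₁ A) ∧ IsHilbertSchmidt (oddPart H₁ A)

/-- The extended Fredholm determinant `Det T`, for `T - 1` in `𝓛_{1|2}(H)`:
`Det (1 + A) = Det ((1 + A) e^{-A}) · e^{Tr A_even}`. -/
def extDet (T : H →L[ℂ] H) : ℂ :=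
  fredholmDet (T * NormedSpace.exp (-(T - 1))) * Complex.exp (trace (evenPart H₁ (T - 1)))

/-- `J = P₁ - P₂`. -/
def J : H →L[ℂ] H := H₁.starProjection - H₁ᗮ.starProjection

/-- `A` is `J`-self-adjoint: `[A f, g] = [f, A g]`, where `[f, g] = (J f, g)`. -/
def IsJSelfAdjoint (A : H →L[ℂ] H) : Prop :=
  ∀ f g : H, ⟪J H₁ (A f), g⟫_ℂ = ⟪J H₁ f, A g⟫_ℂ

end Splitting

end ExtFredholm

end

/-! Every determinant involved is a limit of finite ones. If `B = C⋆ D` with Hilbert-Schmidt `C`,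
`D`, the matrix entries of `B` are `⟪C eᵢ, D eⱼ⟫`, and Hadamard's inequality bounds the principal
minor over `s` by `∏_{i ∈ s} ‖C eᵢ‖ ‖D eᵢ‖`, which is summable over all finite `s`. Dominated
convergence for the sum of minors (`tendsto_det_one_add_finSection`) then gives convergence of
finite-section determinants, even when the operators vary with the section. An infinite form of `det
(1 + UV) = det (1 + VU)` makes the limit independent of the basis (`fdet_opMat_eq`). Self-adjoint
trace class operators have this form (`IsTraceClass.exists_hs`); the even part of a `J`-self-adjoint
operator is one of them.

For the extended determinant, `(1 - A) e^A - 1 = A G A` is again a product of Hilbert-Schmidt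
operators. On finite sections `det e^M = e^{Tr M}`, so the exponentials cancel and `Det (1 - A)` is
the limit of the plain determinants `det (1 - A_F)` in a basis adapted to the splitting
(`tendsto_det_extDet`). There each of them is a 2×2 block determinant. The Schur complement formula
factors it, both factors converge, and uniqueness of limits gives the product formula
(`extDet_one_sub_eq_mul`).

For positivity, `J`-self-adjointness makes the diagonal blocks self-adjoint and gives `A₂₁ = -A₁₂⋆`.
Hence the operator in the second factor is `A₂₂ - A₁₂⋆ (1 - A₁₁)⁻¹ A₁₂ ≤ A₂₂ ≤ ‖A₂₂‖ < 1`. Both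
factors are thus of the form `Det (1 - B)` with `B` self-adjoint and `B ≤ q < 1`. A lower bound on
the finite determinants, uniform in the section, keeps the limit strictly positive
(`fredholmDet_one_sub_pos`). -/

set_option linter.unusedSectionVars false

open Filter Topology

noncomputable section

namespace ExtFredholm

/-! ### Principal minors and the expansion of `det (1 + M)`. -/

section Minors

variable {ι : Type*}

/-- The finite section of an infinite matrix. -/
def finSection (b : Matrix ι ι ℂ) (s : Finset ι) : Matrix s s ℂ :=
  b.submatrix Subtype.val Subtype.val

/-- A principal minor of an infinite matrix. -/
def minor (b : Matrix ι ι ℂ) (s : Finset ι) : ℂ := open scoped Classical in (finSection b s).det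

/-- The Fredholm determinant of `1 + b`, the sum of all principal minors of `b`. -/
def fdet (b : Matrix ι ι ℂ) : ℂ := ∑' s : Finset ι, minor b s

/-- Multilinear expansion in the rows: each row comes from `M` or from the identity, and the
identity rows drop out of the determinant. -/
theorem det_one_add_eq_sum_minors {n : Type*} [Fintype n] [DecidableEq n] (M : Matrix n n ℂ) :
    (1 + M).det = ∑ s : Finset n, minor M s := by
  rw [add_comm]
  change (Matrix.detRowAlternating : (n → ℂ) [⋀^n]→ₗ[ℂ] ℂ) (M.row + (1 : Matrix n n ℂ).row) = _
  rw [AlternatingMap.map_add_univ]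
  refine Finset.sum_congr rfl fun s _ => ?_
  rw [minor, finSection]
  convert! Matrix.det_piecewise_one_eq_submatrix_det M s

theorem minor_eq_det_of_equiv {n : Type*} [Fintype n] [DecidableEq n] (b : Matrix ι ι ℂ)
    (s : Finset ι) (e : n ≃ s) : minor b s = (Matrix.of fun i j : n => b (e i) (e j)).det := by
  classical
  rw [minor, ← Matrix.det_submatrix_equiv_self e]
  congr! 1

theorem det_one_add_finSection [DecidableEq ι] (b : Matrix ι ι ℂ) (F : Finset ι) :
    (1 + finSection b F).det = ∑ s ∈ F.powerset, minor b s := by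
  rw [det_one_add_eq_sum_minors]
  refine Finset.sum_nbij' (fun s => s.map (Function.Embedding.subtype _))
    (fun t => t.subtype (· ∈ F)) ?_ ?_ ?_ ?_ ?_
  · intro s _
    simp only [Finset.mem_powerset]
    intro i hi
    simp only [Finset.mem_map, Function.Embedding.subtype_apply] at hi
    obtain ⟨a, _, rfl⟩ := hi
    exact a.2
  · simp
  · intro s _
    ext; simp
  · intro t ht
    ext i
    simp only [Finset.mem_powerset] at ht
    simp only [Finset.mem_map, Finset.mem_subtype, Function.Embedding.subtype_apply, Subtype.exists,
      exists_and_left, exists_prop, exists_eq_right_right]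
    exact ⟨fun h => h.1, fun h => ⟨h, ht h⟩⟩
  · intro s _
    classical
    let g : s ≃ s.map (Function.Embedding.subtype (· ∈ F)) := Equiv.ofBijective
      (fun i => ⟨i.1, Finset.mem_map_of_mem (Function.Embedding.subtype _) i.2⟩)
      ⟨fun i j hij => Subtype.ext (Subtype.ext (congrArg (fun z => (z.1 : ι)) hij)), by
        rintro ⟨j, hj⟩
        obtain ⟨k, hk, rfl⟩ := Finset.mem_map.1 hj
        exact ⟨⟨k, hk⟩, rfl⟩⟩
    rw [minor_eq_det_of_equiv b _ g, minor]
    congr! 1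

end Minors

/-! ### Hadamard's inequality for matrices of inner products. -/

section Hadamard

open Module

/-- In the Gram-Schmidt basis `g` of `x` the coordinate matrix is triangular with diagonal `⟪g i, x
i⟫`; the change of basis is unitary. -/
theorem norm_det_toMatrix_le {n : ℕ} {V : Type*} [NormedAddCommGroup V] [InnerProductSpace ℂ V]
    [FiniteDimensional ℂ V] (h : finrank ℂ V = Fintype.card (Fin n))
    (f : OrthonormalBasis (Fin n) ℂ V) (x : Fin n → V) :
    ‖(f.toBasis.toMatrix x).det‖ ≤ ∏ i, ‖x i‖ := by
  set g := InnerProductSpace.gramSchmidtOrthonormalBasis h x with hg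
  have h1 : f.toBasis.toMatrix x = f.toBasis.toMatrix g.toBasis * g.toBasis.toMatrix x :=
    (Basis.toMatrix_mul_toMatrix _ _ _).symm
  have h2 : ‖(f.toBasis.toMatrix g.toBasis).det‖ = 1 := by
    have := Matrix.det_of_mem_unitary (f.toMatrix_orthonormalBasis_mem_unitary g)
    rw [OrthonormalBasis.coe_toBasis]
    exact CStarRing.norm_of_mem_unitary this
  have h3 : (g.toBasis.toMatrix x).det = ∏ i, ⟪g i, x i⟫_ℂ :=
    InnerProductSpace.gramSchmidtOrthonormalBasis_det h x
  rw [h1, Matrix.det_mul, norm_mul, h2, one_mul, h3, norm_prod]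
  refine Finset.prod_le_prod (fun _ _ => norm_nonneg _) fun i _ => ?_
  calc _ ≤ ‖g i‖ * ‖x i‖ := norm_inner_le_norm _ _
    _ = _ := by rw [g.norm_eq_one, one_mul]

variable {K : Type*} [NormedAddCommGroup K] [InnerProductSpace ℂ K]

/-- Projecting the `x i` onto the span of `y` changes no entry, and there the matrix factors into
two coordinate matrices, each under Hadamard's bound. If `y` is linearly dependent, the determinant
vanishes. -/
theorem norm_det_inner_le_fin {n : ℕ} (x y : Fin n → K) :
    ‖(Matrix.of fun i j => ⟪x i, y j⟫_ℂ).det‖ ≤ ∏ i, ‖x i‖ * ‖y i‖ := by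
  by_cases hy : LinearIndependent ℂ y
  · set V := Submodule.span ℂ (Set.range y) with hV
    have hfin : FiniteDimensional ℂ V := FiniteDimensional.span_of_finite ℂ (Set.finite_range y)
    have h : finrank ℂ V = Fintype.card (Fin n) := finrank_span_eq_card hy
    let y' : Fin n → V := fun i => ⟨y i, Submodule.subset_span ⟨i, rfl⟩⟩
    let x' : Fin n → V := fun i => V.orthogonalProjectionOnto (x i)
    let f := InnerProductSpace.gramSchmidtOrthonormalBasis h y'
    have h1 : (Matrix.of fun i j => ⟪x i, y j⟫_ℂ) =
        (f.toBasis.toMatrix x').conjTranspose * f.toBasis.toMatrix y' := by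
      ext i j
      have e1 : ⟪x i, y j⟫_ℂ = ⟪x' i, y' j⟫_ℂ :=
        (Submodule.inner_orthogonalProjectionOnto_eq_of_mem_right (y' j) (x i)).symm
      rw [Matrix.of_apply, e1, ← f.sum_inner_mul_inner, Matrix.mul_apply]
      refine Finset.sum_congr rfl fun k _ => ?_
      simp [Basis.toMatrix_apply, OrthonormalBasis.coe_toBasis_repr_apply,
        OrthonormalBasis.repr_apply_apply, inner_conj_symm]
    rw [h1, Matrix.det_mul, Matrix.det_conjTranspose, norm_mul, norm_star, Finset.prod_mul_distrib]
    refine mul_le_mul ((norm_det_toMatrix_le h f x').trans ?_)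
      (norm_det_toMatrix_le h f y') (norm_nonneg _) (Finset.prod_nonneg fun _ _ => norm_nonneg _)
    exact Finset.prod_le_prod (fun _ _ => norm_nonneg _) fun i _ =>
      V.norm_orthogonalProjectionOnto_apply_le (x i)
  · obtain ⟨g, hg, i, hi⟩ := Fintype.not_linearIndependent_iff.1 hy
    have : (Matrix.of fun i j => ⟪x i, y j⟫_ℂ).det = 0 := by
      rw [← Matrix.exists_mulVec_eq_zero_iff]
      refine ⟨g, fun h => hi (by simp [h]), ?_⟩
      ext k
      have := congrArg (fun z => ⟪x k, z⟫_ℂ) hg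
      simpa [inner_sum, inner_smul_right, Matrix.mulVec, dotProduct, mul_comm] using this
    rw [this, norm_zero]
    positivity

theorem norm_minor_inner_le {ι : Type*} (x y : ι → K) (s : Finset ι) :
    ‖minor (Matrix.of fun i j => ⟪x i, y j⟫_ℂ) s‖ ≤ ∏ i ∈ s, ‖x i‖ * ‖y i‖ := by
  rw [minor_eq_det_of_equiv _ s s.equivFin.symm]
  refine (norm_det_inner_le_fin (fun k => x (s.equivFin.symm k))
    (fun k => y (s.equivFin.symm k))).trans_eq ?_
  rw [Equiv.prod_comp s.equivFin.symm (fun i : s => ‖x i‖ * ‖y i‖)]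
  exact Finset.prod_coe_sort s fun i => ‖x i‖ * ‖y i‖

end Hadamard

/-! ### Dominated convergence for sums of minors. -/

section Tannery

variable {K : Type*} [NormedAddCommGroup K] [InnerProductSpace ℂ K] {ι α : Type*} {l : Filter α}
  {x y : α → ι → K} {b : Matrix ι ι ℂ} {a : ι → ℝ}

theorem summable_minor_inner {x y : ι → K} (h : Summable fun i => ‖x i‖ * ‖y i‖) :
    Summable fun s => ‖minor (Matrix.of fun i j => ⟪x i, y j⟫_ℂ) s‖ :=
  (summable_finsetProd_of_summable_nonneg (fun _ => by positivity) h).of_nonneg_of_le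
    (fun _ => norm_nonneg _) (norm_minor_inner_le x y)

theorem tendsto_matrix {m n : Type*} {M' : α → Matrix m n ℂ} {M : Matrix m n ℂ}
    (h : ∀ i j, Tendsto (fun t => M' t i j) l (𝓝 (M i j))) : Tendsto M' l (𝓝 M) :=
  tendsto_pi_nhds.2 fun i => tendsto_pi_nhds.2 (h i)

theorem tendsto_minor {b' : α → Matrix ι ι ℂ} (h : ∀ i j, Tendsto (fun t => b' t i j) l (𝓝 (b i j)))
    (s : Finset ι) : Tendsto (fun t => minor (b' t) s) l (𝓝 (minor b s)) := by
  classical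
  have hc : Continuous fun M : Matrix s s ℂ => M.det := Continuous.matrix_det continuous_id
  have hM : Tendsto (fun t => finSection (b' t) s) l (𝓝 (finSection b s)) :=
    tendsto_matrix fun i j => h i j
  exact (hc.tendsto _).comp hM

theorem tendsto_fdet (ha0 : ∀ i, 0 ≤ a i) (ha : Summable a)
    (hbd : ∀ᶠ t in l, ∀ i, ‖x t i‖ * ‖y t i‖ ≤ a i)
    (hlim : ∀ i j, Tendsto (fun t => ⟪x t i, y t j⟫_ℂ) l (𝓝 (b i j))) :
    Tendsto (fun t => fdet (Matrix.of fun i j => ⟪x t i, y t j⟫_ℂ)) l (𝓝 (fdet b)) := by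
  refine tendsto_tsum_of_dominated_convergence
    (summable_finsetProd_of_summable_nonneg ha0 ha) (fun s => tendsto_minor hlim s) ?_
  filter_upwards [hbd] with t ht s
  exact (norm_minor_inner_le (x t) (y t) s).trans
    (Finset.prod_le_prod (fun _ _ => by positivity) fun i _ => ht i)

/-- The finite determinant is the sum of minors cut off to subsets of `F t`. The products `∏_{i ∈ s}
a i` dominate, and each fixed `s` eventually lies in `F t`. Vectors and section may vary together.
-/
theorem tendsto_det_one_add_finSection [DecidableEq ι] (ha0 : ∀ i, 0 ≤ a i) (ha : Summable a)
    (hbd : ∀ᶠ t in l, ∀ i, ‖x t i‖ * ‖y t i‖ ≤ a i)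
    (hlim : ∀ i j, Tendsto (fun t => ⟪x t i, y t j⟫_ℂ) l (𝓝 (b i j)))
    {F : α → Finset ι} (hF : Tendsto F l atTop) :
    Tendsto (fun t => (1 + finSection (Matrix.of fun i j => ⟪x t i, y t j⟫_ℂ) (F t)).det) l
      (𝓝 (fdet b)) := by
  have key : ∀ t, (1 + finSection (Matrix.of fun i j => ⟪x t i, y t j⟫_ℂ) (F t)).det =
      ∑' s, if s ⊆ F t then minor (Matrix.of fun i j => ⟪x t i, y t j⟫_ℂ) s else 0 := by
    intro t
    rw [det_one_add_finSection, tsum_eq_sum (s := (F t).powerset)]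
    · exact Finset.sum_congr rfl fun s hs => by rw [if_pos (Finset.mem_powerset.1 hs)]
    · exact fun s hs => if_neg (fun h => hs (Finset.mem_powerset.2 h))
  simp_rw [key]
  refine tendsto_tsum_of_dominated_convergence
    (summable_finsetProd_of_summable_nonneg ha0 ha) (fun s => ?_) ?_
  · refine (tendsto_minor (b' := fun t => Matrix.of fun i j => ⟪x t i, y t j⟫_ℂ) hlim s).congr' ?_
    filter_upwards [hF.eventually_ge_atTop s] with t ht
    rw [if_pos (show s ⊆ F t from ht)]
  · filter_upwards [hbd] with t ht s
    split_ifs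
    · exact (norm_minor_inner_le (x t) (y t) s).trans
        (Finset.prod_le_prod (fun _ _ => by positivity) fun i _ => ht i)
    · rw [norm_zero]
      exact Finset.prod_nonneg fun i _ => ha0 i

end Tannery

/-! ### Projections onto finitely many basis vectors. -/

section Proj

variable {H : Type*} [NormedAddCommGroup H] [InnerProductSpace ℂ H] {ι : Type*}
  (e : HilbertBasis ι ℂ H)

/-- The orthogonal projection onto the span of finitely many basis vectors. -/
def proj (Q : Finset ι) : H →L[ℂ] H := ∑ i ∈ Q, InnerProductSpace.rankOne ℂ (e i) (e i)

theorem proj_apply (Q : Finset ι) (x : H) : proj e Q x = ∑ i ∈ Q, ⟪e i, x⟫_ℂ • e i := by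
  simp [proj]

theorem inner_proj_left (Q : Finset ι) (x y : H) : ⟪proj e Q x, y⟫_ℂ = ⟪x, proj e Q y⟫_ℂ := by
  simp only [proj_apply, sum_inner, inner_sum, inner_smul_left, inner_smul_right, inner_conj_symm]
  exact Finset.sum_congr rfl fun _ _ => mul_comm _ _

theorem proj_basis [DecidableEq ι] (Q : Finset ι) (i : ι) :
    proj e Q (e i) = if i ∈ Q then e i else 0 := by
  simp [proj_apply, orthonormal_iff_ite.1 e.orthonormal, ite_smul]

theorem proj_proj (Q : Finset ι) (x : H) : proj e Q (proj e Q x) = proj e Q x := by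
  classical
  conv_lhs => rw [proj_apply e Q x]
  rw [map_sum, proj_apply]
  refine Finset.sum_congr rfl fun i hi => ?_
  rw [map_smul, proj_basis, if_pos hi]

theorem norm_proj_apply_le (Q : Finset ι) (x : H) : ‖proj e Q x‖ ≤ ‖x‖ := by
  have h : ‖proj e Q x‖ ^ 2 = RCLike.re ⟪x, proj e Q x⟫_ℂ := by
    rw [← proj_proj, ← inner_proj_left, proj_proj, inner_self_eq_norm_sq]
  have h2 : RCLike.re ⟪x, proj e Q x⟫_ℂ ≤ ‖x‖ * ‖proj e Q x‖ := re_inner_le_norm _ _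
  by_contra! hc
  nlinarith [norm_nonneg x, norm_nonneg (proj e Q x)]

theorem norm_proj_le (Q : Finset ι) : ‖proj e Q‖ ≤ 1 :=
  ContinuousLinearMap.opNorm_le_bound _ zero_le_one fun x => by
    simpa using norm_proj_apply_le e Q x

theorem tendsto_proj (x : H) : Tendsto (fun Q => proj e Q x) atTop (𝓝 x) := by
  have h : Tendsto (fun Q : Finset ι => ∑ i ∈ Q, e.repr x i • e i) atTop (𝓝 x) := e.hasSum_repr x
  simpa only [proj_apply, e.repr_apply_apply] using h

theorem norm_basis (i : ι) : ‖e i‖ = 1 := e.orthonormal.1 i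

end Proj

/-! ### Sylvester's determinant identity in infinite dimension. -/

section Sylvester

variable {K : Type*} [NormedAddCommGroup K] [InnerProductSpace ℂ K] {ι κ : Type*}

/-- Projecting the `x i` with `Q` reduces the identity to finite matrices `U`, `V`. The index set of
`i` is exhausted first, with `Q` fixed, and then `Q` grows. For `x = C e`, `y = D e` the left side
involves only `D C⋆`, so the basis `e` disappears from it. -/
theorem tendsto_det_one_add_sylvester [DecidableEq κ] (f : HilbertBasis κ ℂ K) {x y : ι → K}
    (h : Summable fun i => ‖x i‖ * ‖y i‖) :
    Tendsto (fun Q : Finset κ =>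
      (1 + finSection (Matrix.of fun k l => ∑' i, ⟪f k, y i⟫_ℂ * ⟪x i, f l⟫_ℂ) Q).det) atTop
      (𝓝 (fdet (Matrix.of fun i j => ⟪x i, y j⟫_ℂ))) := by
  classical
  have hs : ∀ k l, Summable fun i => ⟪f k, y i⟫_ℂ * ⟪x i, f l⟫_ℂ := fun k l => by
    refine Summable.of_norm_bounded h fun i => ?_
    rw [norm_mul, mul_comm]
    have h1 := norm_inner_le_norm (𝕜 := ℂ) (x i) (f l)
    have h2 := norm_inner_le_norm (𝕜 := ℂ) (f k) (y i)
    rw [norm_basis, mul_one] at h1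
    rw [norm_basis, one_mul] at h2
    gcongr
  have hb : ∀ (Q : Finset κ) i, ‖proj f Q (x i)‖ * ‖y i‖ ≤ ‖x i‖ * ‖y i‖ := fun Q i => by
    gcongr
    exact norm_proj_apply_le f Q _
  have key : ∀ Q : Finset κ,
      (1 + finSection (Matrix.of fun k l => ∑' i, ⟪f k, y i⟫_ℂ * ⟪x i, f l⟫_ℂ) Q).det =
        fdet (Matrix.of fun i j => ⟪proj f Q (x i), y j⟫_ℂ) := by
    intro Q
    have t1 : Tendsto (fun P : Finset ι =>
        (1 + finSection (Matrix.of fun i j => ⟪proj f Q (x i), y j⟫_ℂ) P).det) atTop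
        (𝓝 (fdet (Matrix.of fun i j => ⟪proj f Q (x i), y j⟫_ℂ))) :=
      tendsto_det_one_add_finSection (x := fun _ i => proj f Q (x i)) (y := fun _ => y)
        (fun _ => by positivity) h (Eventually.of_forall fun _ => hb Q)
        (fun i j => tendsto_const_nhds) tendsto_id
    have t2 : Tendsto (fun P : Finset ι =>
        (1 + (Matrix.of fun k l : Q => ∑ i ∈ P, ⟪f k, y i⟫_ℂ * ⟪x i, f l⟫_ℂ)).det) atTop
        (𝓝 (1 + finSection (Matrix.of fun k l =>
          ∑' i, ⟪f k, y i⟫_ℂ * ⟪x i, f l⟫_ℂ) Q).det) := by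
      have hc : Continuous fun M : Matrix Q Q ℂ => (1 + M).det :=
        Continuous.matrix_det (continuous_const.add continuous_id)
      exact (hc.tendsto _).comp (tendsto_matrix fun k l => (hs k l).hasSum)
    refine tendsto_nhds_unique (t2.congr fun P => ?_) t1
    let U : Matrix P Q ℂ := Matrix.of fun i k => ⟪x i, f k⟫_ℂ
    let V : Matrix Q P ℂ := Matrix.of fun k i => ⟪f k, y i⟫_ℂ
    have h1 : (Matrix.of fun k l : Q => ∑ i ∈ P, ⟪f k, y i⟫_ℂ * ⟪x i, f l⟫_ℂ) = V * U := by
      ext k l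
      rw [Matrix.mul_apply]
      exact (Finset.sum_coe_sort P fun i => ⟪f k, y i⟫_ℂ * ⟪x i, f l⟫_ℂ).symm
    have h2 : finSection (Matrix.of fun i j => ⟪proj f Q (x i), y j⟫_ℂ) P = U * V := by
      ext i j
      rw [Matrix.mul_apply]
      simp only [finSection, Matrix.submatrix_apply, Matrix.of_apply, U, V]
      rw [inner_proj_left, proj_apply, inner_sum]
      simp only [inner_smul_right]
      rw [← Finset.sum_coe_sort Q]
      exact Finset.sum_congr rfl fun _ _ => mul_comm _ _
    rw [h1, h2, Matrix.det_one_add_mul_comm]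
  simp_rw [key]
  exact tendsto_fdet (x := fun Q i => proj f Q (x i)) (y := fun _ => y)
    (fun _ => by positivity) h (Eventually.of_forall hb)
    (fun i j => ((tendsto_proj f (x i)).inner tendsto_const_nhds))

end Sylvester

/-! ### Hilbert-Schmidt operators and norm convergence of compressions. -/

section HilbertSchmidt

open scoped ENNReal

variable {H K L : Type*} [NormedAddCommGroup H] [InnerProductSpace ℂ H] [CompleteSpace H]
  [NormedAddCommGroup K] [InnerProductSpace ℂ K] [CompleteSpace K]
  [NormedAddCommGroup L] [InnerProductSpace ℂ L] [CompleteSpace L]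
  {ι κ : Type*} (e : HilbertBasis ι ℂ H) (f : HilbertBasis κ ℂ K)

theorem summable_norm_sq_iff {E : Type*} [NormedAddCommGroup E] (v : ι → E) :
    Summable (fun i => ‖v i‖ ^ 2) ↔ ∑' i, ‖v i‖ₑ ^ 2 ≠ ∞ := by
  have h : ∀ i, ‖v i‖ₑ ^ 2 = ((‖v i‖₊ ^ 2 : NNReal) : ℝ≥0∞) := fun i => by
    rw [ENNReal.coe_pow]; rfl
  simp_rw [h]
  rw [ENNReal.tsum_coe_ne_top_iff_summable, ← NNReal.summable_coe]
  simp

omit [CompleteSpace K] in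
theorem hasSum_norm_inner_sq (x : K) : HasSum (fun k => ‖⟪f k, x⟫_ℂ‖ ^ 2) (‖x‖ ^ 2) := by
  have h := (f.hasSum_inner_mul_inner x x).mapL Complex.reCLM
  convert! h using 1
  · ext k
    rw [← inner_conj_symm x (f k), mul_comm, Complex.mul_conj, Complex.normSq_eq_norm_sq,
      Complex.reCLM_apply, Complex.ofReal_re]
  · exact (inner_self_eq_norm_sq (𝕜 := ℂ) x).symm

omit [CompleteSpace K] in
theorem tsum_enorm_inner_sq (x : K) : ∑' k, ‖⟪f k, x⟫_ℂ‖ₑ ^ 2 = ‖x‖ₑ ^ 2 := by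
  have h : ∀ z : ℝ, 0 ≤ z → ENNReal.ofReal z ^ 2 = ENNReal.ofReal (z ^ 2) := fun z hz =>
    (ENNReal.ofReal_pow hz 2).symm
  simp only [← ofReal_norm, h _ (norm_nonneg _)]
  rw [← (hasSum_norm_inner_sq f x).tsum_eq, ENNReal.ofReal_tsum_of_nonneg
    (fun _ => by positivity) (hasSum_norm_inner_sq f x).summable]

/-- Parseval on both sides and an exchange of sums, unconditional in `ℝ≥0∞`. The right side does not
see `e`, whence basis independence. -/
theorem tsum_enorm_sq_adjoint (T : H →L[ℂ] K) :
    ∑' i, ‖T (e i)‖ₑ ^ 2 = ∑' k, ‖T.adjoint (f k)‖ₑ ^ 2 := by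
  simp_rw [← tsum_enorm_inner_sq f, ← tsum_enorm_inner_sq e]
  rw [ENNReal.tsum_comm]
  refine tsum_congr fun k => tsum_congr fun i => ?_
  rw [ContinuousLinearMap.adjoint_inner_right, ← inner_conj_symm (T (e i)),
    ← ofReal_norm, ← ofReal_norm, RCLike.norm_conj]

/-- Hilbert-Schmidt operators between two Hilbert spaces. -/
def HS (T : H →L[ℂ] K) : Prop := Summable fun i : BasisIndex H => ‖T (onb H i)‖ ^ 2

variable {S T : H →L[ℂ] K}

theorem hs_iff : HS T ↔ Summable fun i => ‖T (e i)‖ ^ 2 := by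
  rw [HS, summable_norm_sq_iff, summable_norm_sq_iff, tsum_enorm_sq_adjoint (onb H) (onb K),
    tsum_enorm_sq_adjoint e (onb K)]

theorem hs_adjoint_iff : HS T.adjoint ↔ HS T := by
  rw [HS, HS, summable_norm_sq_iff, summable_norm_sq_iff, tsum_enorm_sq_adjoint (onb H) (onb K)]

theorem HS.summable (hT : HS T) : Summable fun i => ‖T (e i)‖ ^ 2 := (hs_iff e).1 hT

theorem HS.adjoint (hT : HS T) : HS T.adjoint := hs_adjoint_iff.2 hT

theorem HS.tsum_norm_sq_adjoint (hT : HS T) :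
    ∑' i, ‖T (e i)‖ ^ 2 = ∑' k, ‖T.adjoint (f k)‖ ^ 2 := by
  have h := tsum_enorm_sq_adjoint e f T
  simp only [← ofReal_norm, ← ENNReal.ofReal_pow (norm_nonneg _)] at h
  rw [← ENNReal.ofReal_tsum_of_nonneg (fun _ => by positivity) (hT.summable e),
    ← ENNReal.ofReal_tsum_of_nonneg (fun _ => by positivity) (hT.adjoint.summable f)] at h
  exact (ENNReal.ofReal_eq_ofReal_iff (tsum_nonneg fun _ => by positivity)
    (tsum_nonneg fun _ => by positivity)).1 h

theorem HS.comp_left (hT : HS T) (S : K →L[ℂ] L) : HS (S ∘L T) := by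
  refine Summable.of_nonneg_of_le (fun _ => by positivity) (fun i => ?_)
    (Summable.mul_left (‖S‖ ^ 2) hT)
  rw [← mul_pow]
  gcongr
  exact S.le_opNorm _

theorem HS.comp_right (hT : HS T) (S : L →L[ℂ] H) : HS (T ∘L S) := by
  rw [← hs_adjoint_iff, ContinuousLinearMap.adjoint_comp]
  exact hT.adjoint.comp_left _

theorem HS.neg (hT : HS T) : HS (-T) := by simpa [HS] using hT

theorem HS.add (hS : HS S) (hT : HS T) : HS (S + T) := by
  refine Summable.of_nonneg_of_le (fun _ => by positivity) (fun i => ?_)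
    ((Summable.add hS hT).mul_left 2)
  have h := norm_add_le (S (onb H i)) (T (onb H i))
  rw [add_apply]
  nlinarith [norm_nonneg (S (onb H i) + T (onb H i)), sq_nonneg (‖S (onb H i)‖ - ‖T (onb H i)‖)]

theorem HS.summable_mul (hS : HS S) (hT : HS T) : Summable fun i => ‖S (e i)‖ * ‖T (e i)‖ := by
  refine Summable.of_nonneg_of_le (fun _ => by positivity) (fun i => ?_)
    ((hS.summable e).add (hT.summable e))
  nlinarith [sq_nonneg (‖S (e i)‖ - ‖T (e i)‖), sq_nonneg ‖S (e i)‖, sq_nonneg ‖T (e i)‖]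

theorem enorm_apply_sq_le (T : H →L[ℂ] K) (x : H) :
    ‖T x‖ₑ ^ 2 ≤ (∑' i, ‖T (e i)‖ₑ ^ 2) * ‖x‖ₑ ^ 2 := by
  rw [tsum_enorm_sq_adjoint e (onb K), ← tsum_enorm_inner_sq (onb K), ← ENNReal.tsum_mul_right]
  refine ENNReal.tsum_le_tsum fun k => ?_
  rw [← ContinuousLinearMap.adjoint_inner_left, ← mul_pow]
  gcongr
  rw [← ofReal_norm, ← ofReal_norm, ← ofReal_norm,
    ← ENNReal.ofReal_mul (norm_nonneg _)]
  exact ENNReal.ofReal_le_ofReal (norm_inner_le_norm _ _)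

theorem HS.opNorm_sq_le (hT : HS T) : ‖T‖ ^ 2 ≤ ∑' i, ‖T (e i)‖ ^ 2 := by
  have hs := hT.summable e
  have h0 : 0 ≤ ∑' i, ‖T (e i)‖ ^ 2 := tsum_nonneg fun _ => by positivity
  have h := T.opNorm_le_bound (Real.sqrt_nonneg (∑' i, ‖T (e i)‖ ^ 2)) fun x => by
    rw [← abs_norm (T x), ← Real.sqrt_sq_eq_abs, ← abs_norm x, ← Real.sqrt_sq_eq_abs (‖x‖),
      ← Real.sqrt_mul h0]
    refine Real.sqrt_le_sqrt ?_
    have h1 := enorm_apply_sq_le e T x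
    simp only [← ofReal_norm, ← ENNReal.ofReal_pow (norm_nonneg _)] at h1
    rwa [← ENNReal.ofReal_tsum_of_nonneg (fun _ => by positivity) hs, ← ENNReal.ofReal_mul h0,
      ENNReal.ofReal_le_ofReal_iff (by positivity)] at h1
  calc ‖T‖ ^ 2 ≤ √(∑' i, ‖T (e i)‖ ^ 2) ^ 2 := by gcongr
    _ = _ := Real.sq_sqrt h0

/-- The compression of an operator to the span of finitely many basis vectors. -/
def compression (A : H →L[ℂ] H) (F : Finset ι) : H →L[ℂ] H := proj e F * A * proj e F

theorem compression_apply (A : H →L[ℂ] H) (F : Finset ι) (x : H) :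
    compression e A F x = proj e F (A (proj e F x)) := rfl

theorem norm_compression_le (A : H →L[ℂ] H) (F : Finset ι) : ‖compression e A F‖ ≤ ‖A‖ := by
  calc ‖compression e A F‖ ≤ ‖proj e F‖ * ‖A‖ * ‖proj e F‖ :=
        (norm_mul_le _ _).trans (by gcongr; exact norm_mul_le _ _)
    _ ≤ 1 * ‖A‖ * 1 := by gcongr <;> exact norm_proj_le e F
    _ = ‖A‖ := by ring

theorem norm_compression_basis_le (A : H →L[ℂ] H) (F : Finset ι) (i : ι) :
    ‖compression e A F (e i)‖ ≤ ‖A (e i)‖ := by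
  classical
  rw [compression_apply, proj_basis]
  split_ifs
  · exact norm_proj_apply_le e F _
  · simp

/-- The Hilbert-Schmidt norm dominates the operator norm, and the former tends to zero by dominated
convergence with majorant `4 ‖A eᵢ‖²`. -/
theorem tendsto_compression {A : H →L[ℂ] H} (hA : HS A) :
    Tendsto (compression e A) atTop (𝓝 A) := by
  classical
  rw [tendsto_iff_norm_sub_tendsto_zero]
  have hHS : ∀ F, HS (compression e A F - A) := fun F => by
    rw [sub_eq_add_neg]
    exact ((hA.comp_left (proj e F)).comp_right (proj e F)).add hA.neg
  have h1 : Tendsto (fun F => ∑' i, ‖(compression e A F - A) (e i)‖ ^ 2) atTop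
      (𝓝 (∑' _ : ι, (0 : ℝ))) := by
    refine tendsto_tsum_of_dominated_convergence ((hA.summable e).mul_left 4) (fun i => ?_)
      (Eventually.of_forall fun F i => ?_)
    · have : Tendsto (fun F => ‖proj e F (A (e i)) - A (e i)‖ ^ 2) atTop (𝓝 (0 ^ 2)) :=
        (tendsto_iff_norm_sub_tendsto_zero.1 (tendsto_proj e (A (e i)))).pow 2
      rw [zero_pow two_ne_zero] at this
      refine this.congr' ?_
      filter_upwards [eventually_ge_atTop {i}] with F hF
      rw [sub_apply, compression_apply, proj_basis, if_pos (hF (Finset.mem_singleton_self i))]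
    · rw [Real.norm_of_nonneg (by positivity), sub_apply]
      have h2 := norm_sub_le (compression e A F (e i)) (A (e i))
      have h3 := norm_compression_basis_le e A F i
      nlinarith [norm_nonneg (compression e A F (e i) - A (e i))]
  rw [tsum_zero] at h1
  have h2 : Tendsto (fun F => ‖compression e A F - A‖ ^ 2) atTop (𝓝 0) :=
    squeeze_zero (fun _ => by positivity) (fun F => (hHS F).opNorm_sq_le e) h1
  simpa [Real.sqrt_sq (norm_nonneg _)] using h2.sqrt

end HilbertSchmidt

/-! ### The trace of a product of Hilbert-Schmidt operators. -/

section Trace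

variable {H K : Type*} [NormedAddCommGroup H] [InnerProductSpace ℂ H] [CompleteSpace H]
  [NormedAddCommGroup K] [InnerProductSpace ℂ K] [CompleteSpace K]
  {ι κ : Type*} (e : HilbertBasis ι ℂ H) (f : HilbertBasis κ ℂ K) {C D : H →L[ℂ] K}

theorem HS.summable_inner (hC : HS C) (hD : HS D) : Summable fun i => ⟪C (e i), D (e i)⟫_ℂ :=
  Summable.of_norm_bounded (hC.summable_mul e hD) fun _ => norm_inner_le_norm _ _

theorem HS.summable_prod_norm_sq (hD : HS D) :
    Summable fun p : ι × κ => ‖⟪f p.2, D (e p.1)⟫_ℂ‖ ^ 2 := by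
  rw [summable_prod_of_nonneg fun _ => by positivity]
  refine ⟨fun i => (hasSum_norm_inner_sq f (D (e i))).summable, ?_⟩
  simpa only [(hasSum_norm_inner_sq f _).tsum_eq] using hD.summable e

theorem tsum_inner_eq_tsum_adjoint (hC : HS C) (hD : HS D) :
    ∑' i, ⟪C (e i), D (e i)⟫_ℂ = ∑' k, ⟪D.adjoint (f k), C.adjoint (f k)⟫_ℂ := by
  have hs : Summable fun p : ι × κ => ⟪C (e p.1), f p.2⟫_ℂ * ⟪f p.2, D (e p.1)⟫_ℂ := by
    refine Summable.of_norm_bounded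
      ((hC.summable_prod_norm_sq e f).add (hD.summable_prod_norm_sq e f)) fun p => ?_
    rw [norm_mul, norm_inner_symm]
    nlinarith [sq_nonneg (‖⟪f p.2, C (e p.1)⟫_ℂ‖ - ‖⟪f p.2, D (e p.1)⟫_ℂ‖),
      sq_nonneg ‖⟪f p.2, C (e p.1)⟫_ℂ‖, sq_nonneg ‖⟪f p.2, D (e p.1)⟫_ℂ‖]
  have h1 : ∀ i, ⟪C (e i), D (e i)⟫_ℂ = ∑' k, ⟪C (e i), f k⟫_ℂ * ⟪f k, D (e i)⟫_ℂ :=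
    fun i => (f.tsum_inner_mul_inner _ _).symm
  have h2 : ∀ k, ⟪D.adjoint (f k), C.adjoint (f k)⟫_ℂ =
      ∑' i, ⟪D.adjoint (f k), e i⟫_ℂ * ⟪e i, C.adjoint (f k)⟫_ℂ :=
    fun k => (e.tsum_inner_mul_inner _ _).symm
  rw [tsum_congr h1, tsum_congr h2,
    ← Summable.tsum_comm (f := fun i k => ⟪C (e i), f k⟫_ℂ * ⟪f k, D (e i)⟫_ℂ) hs]
  refine tsum_congr fun k => tsum_congr fun i => ?_
  rw [ContinuousLinearMap.adjoint_inner_left, ContinuousLinearMap.adjoint_inner_right, mul_comm]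

theorem trace_adjoint_comp (hC : HS C) (hD : HS D) :
    trace (C.adjoint ∘L D) = ∑' i, ⟪C (e i), D (e i)⟫_ℂ := by
  rw [tsum_inner_eq_tsum_adjoint e (onb K) hC hD, ← tsum_inner_eq_tsum_adjoint (onb H) _ hC hD]
  simp only [trace, ContinuousLinearMap.comp_apply, ContinuousLinearMap.adjoint_inner_right]

end Trace

/-! ### Self-adjoint trace class operators as Hilbert-Schmidt products. -/

section TraceClass

variable {H K : Type*} [NormedAddCommGroup H] [InnerProductSpace ℂ H] [CompleteSpace H]
  [NormedAddCommGroup K] [InnerProductSpace ℂ K] [CompleteSpace K]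

theorem hs_of_mul_self_eq_abs {B D : H →L[ℂ] H} (hB : IsTraceClass B) (hD : IsSelfAdjoint D)
    (h : D * D = CFC.abs B) : HS D := by
  refine Summable.congr hB fun i => ?_
  rw [← h, ContinuousLinearMap.mul_def, ContinuousLinearMap.comp_apply, ← ContinuousLinearMap.adjoint_inner_left,
    ← ContinuousLinearMap.star_eq_adjoint, hD.star_eq]
  exact inner_self_eq_norm_sq (𝕜 := ℂ) _

/-- The factors are `|B|^{1/2}` and `sgn(B) |B|^{1/2}`. Writing them with `√x ± √(-x)` uses that the
real square root vanishes on negatives and keeps the functions continuous. -/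
theorem IsTraceClass.exists_hs {B : H →L[ℂ] H} (hB : IsTraceClass B) (hsa : IsSelfAdjoint B) :
    ∃ C D : H →L[ℂ] H, HS C ∧ HS D ∧ B = C.adjoint ∘L D := by
  have hplus : ∀ x : ℝ, √x * √x + √(-x) * √(-x) = ‖x‖ ∧ √x * √x - √(-x) * √(-x) = x ∧
      √x * √(-x) = 0 := fun x => by
    rcases le_total 0 x with hx | hx
    · have h : √(-x) = 0 := Real.sqrt_eq_zero_of_nonpos (by linarith)
      rw [h, Real.mul_self_sqrt hx, Real.norm_of_nonneg hx]
      simp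
    · have h : √x = 0 := Real.sqrt_eq_zero_of_nonpos hx
      rw [h, Real.mul_self_sqrt (by linarith : 0 ≤ -x), Real.norm_of_nonpos hx]
      simp
  set C := cfc (fun x : ℝ => √x + √(-x)) B with hC
  set D := cfc (fun x : ℝ => √x - √(-x)) B with hD
  have hCsa : IsSelfAdjoint C := cfc_predicate _ _
  have hDsa : IsSelfAdjoint D := cfc_predicate _ _
  have c1 : Continuous fun x : ℝ => √x + √(-x) := by fun_prop
  have c2 : Continuous fun x : ℝ => √x - √(-x) := by fun_prop
  have habs : CFC.abs B = cfc (fun x : ℝ => ‖x‖) B := CFC.abs_eq_cfc_norm B hsa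
  refine ⟨C, D, hs_of_mul_self_eq_abs hB hCsa ?_, hs_of_mul_self_eq_abs hB hDsa ?_, ?_⟩
  · rw [hC, ← cfc_mul _ _ B c1.continuousOn c1.continuousOn, habs]
    refine cfc_congr fun x _ => ?_
    obtain ⟨h1, h2, h3⟩ := hplus x
    linear_combination h1 + 2 * h3
  · rw [hD, ← cfc_mul _ _ B c2.continuousOn c2.continuousOn, habs]
    refine cfc_congr fun x _ => ?_
    obtain ⟨h1, h2, h3⟩ := hplus x
    linear_combination h1 - 2 * h3
  · rw [← ContinuousLinearMap.star_eq_adjoint, hCsa.star_eq]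
    change B = C * D
    rw [hC, hD, ← cfc_mul _ _ B c1.continuousOn c2.continuousOn]
    conv_lhs => rw [← cfc_id' ℝ B hsa]
    refine cfc_congr fun x _ => ?_
    obtain ⟨h1, h2, h3⟩ := hplus x
    linear_combination -h2

/-- The function `x / (|x| + ε)` is a continuous substitute for the sign, at the cost of an error
`ε`. -/
theorem abs_le_cfc_mul_add {B : H →L[ℂ] H} (hsa : IsSelfAdjoint B) {ε : ℝ} (hε : 0 < ε) :
    ∃ W : H →L[ℂ] H, ‖W‖ ≤ 1 ∧ IsSelfAdjoint W ∧
      CFC.abs B ≤ W * B + algebraMap ℝ (H →L[ℂ] H) ε := by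
  have c1 : Continuous fun x : ℝ => x / (‖x‖ + ε) :=
    continuous_id.div (by fun_prop) fun x => by positivity
  refine ⟨cfc (fun x : ℝ => x / (‖x‖ + ε)) B, ?_, cfc_predicate _ _, ?_⟩
  · refine norm_cfc_le zero_le_one fun x _ => ?_
    rw [norm_div, Real.norm_of_nonneg (by positivity : 0 ≤ ‖x‖ + ε)]
    exact div_le_one_of_le₀ (by linarith) (by positivity)
  · rw [CFC.abs_eq_cfc_norm B hsa]
    conv_rhs => rw [← cfc_id' ℝ B hsa]
    rw [cfc_id' ℝ B hsa]
    have h1 : cfc (fun x : ℝ => x / (‖x‖ + ε)) B * B + algebraMap ℝ (H →L[ℂ] H) ε =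
        cfc (fun x : ℝ => x / (‖x‖ + ε) * x + ε) B := by
      rw [cfc_add_const _ _ B (by fun_prop), cfc_mul _ _ B c1.continuousOn (by fun_prop),
        cfc_id' ℝ B hsa]
    rw [h1]
    refine cfc_mono (fun x _ => ?_) (by fun_prop) (by fun_prop)
    have hp : 0 < ‖x‖ + ε := by positivity
    have hx : x * x = ‖x‖ * ‖x‖ := by rw [Real.norm_eq_abs, abs_mul_abs_self]
    rw [div_mul_eq_mul_div, hx, ← sub_le_iff_le_add, le_div_iff₀ hp]
    nlinarith [sq_nonneg ε]

/-- With `W` the approximate sign of `B`, `|B| ≤ W C⋆ D + ε`, and the diagonal entries of `W C⋆ D`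
are `⟪C W eᵢ, D eᵢ⟫`, bounded by squares. -/
theorem isTraceClass_of_hs {C D : H →L[ℂ] K} (hC : HS C) (hD : HS D)
    (hsa : IsSelfAdjoint (C.adjoint ∘L D)) : IsTraceClass (C.adjoint ∘L D) := by
  set B := C.adjoint ∘L D with hB
  set M := ∑' k, ‖C.adjoint (onb K k)‖ ^ 2 with hM
  have h0 : ∀ x : H, 0 ≤ (⟪x, CFC.abs B x⟫_ℂ).re := fun x => by
    have := (ContinuousLinearMap.nonneg_iff_isPositive _).1 (CFC.abs_nonneg B)
    exact this.re_inner_nonneg_right x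
  refine summable_of_sum_le (c := M + ∑' i, ‖D (onb H i)‖ ^ 2) (fun i => h0 _) fun F => ?_
  have key : ∀ ε : ℝ, 0 < ε → ∑ i ∈ F, (⟪onb H i, CFC.abs B (onb H i)⟫_ℂ).re ≤
      M + ∑' i, ‖D (onb H i)‖ ^ 2 + ε * F.card := by
    intro ε hε
    obtain ⟨W, hW, hWsa, hle⟩ := abs_le_cfc_mul_add hsa hε
    have hCW : HS (C ∘L W) := hC.comp_right W
    -- Passing to adjoints puts the contraction on the outside: `(C W)⋆ = W⋆ C⋆`.
    have hCWM : ∑' i, ‖(C ∘L W) (onb H i)‖ ^ 2 ≤ M := by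
      rw [hCW.tsum_norm_sq_adjoint (onb H) (onb K)]
      refine Summable.tsum_le_tsum (fun k => ?_) hCW.adjoint hC.adjoint
      rw [ContinuousLinearMap.adjoint_comp, ContinuousLinearMap.comp_apply]
      gcongr
      refine (W.adjoint.le_opNorm _).trans ?_
      rw [LinearIsometryEquiv.norm_map]
      exact mul_le_of_le_one_left (norm_nonneg _) hW
    have h1 : ∀ i, (⟪onb H i, CFC.abs B (onb H i)⟫_ℂ).re ≤
        ‖(C ∘L W) (onb H i)‖ ^ 2 + ‖D (onb H i)‖ ^ 2 + ε := fun i => by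
      have h2 := ((ContinuousLinearMap.le_def _ _).1 hle).re_inner_nonneg_right (onb H i)
      have h3 : ⟪onb H i, (W * B) (onb H i)⟫_ℂ = ⟪(C ∘L W) (onb H i), D (onb H i)⟫_ℂ := by
        rw [ContinuousLinearMap.mul_def, ContinuousLinearMap.comp_apply, ← ContinuousLinearMap.adjoint_inner_left,
          ← ContinuousLinearMap.star_eq_adjoint, hWsa.star_eq, hB, ContinuousLinearMap.comp_apply,
          ContinuousLinearMap.adjoint_inner_right, ContinuousLinearMap.comp_apply]
      have h4 : algebraMap ℝ (H →L[ℂ] H) ε (onb H i) = ε • onb H i := by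
        rw [Algebra.algebraMap_eq_smul_one]; rfl
      have h5 : (⟪onb H i, ε • onb H i⟫_ℂ).re = ε := by
        rw [← Complex.coe_smul, inner_smul_right, inner_self_eq_norm_sq_to_K, norm_basis]
        simp
      have h6 := re_inner_le_norm (𝕜 := ℂ) ((C ∘L W) (onb H i)) (D (onb H i))
      rw [sub_apply, add_apply, inner_sub_right, inner_add_right, h3, h4] at h2
      simp only [map_sub, map_add, RCLike.re_eq_complex_re, h5] at h2 h6
      nlinarith [sq_nonneg (‖(C ∘L W) (onb H i)‖ - ‖D (onb H i)‖),
        sq_nonneg ‖(C ∘L W) (onb H i)‖, sq_nonneg ‖D (onb H i)‖]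
    calc _ ≤ ∑ i ∈ F, (‖(C ∘L W) (onb H i)‖ ^ 2 + ‖D (onb H i)‖ ^ 2 + ε) :=
          Finset.sum_le_sum fun i _ => h1 i
      _ = ∑ i ∈ F, ‖(C ∘L W) (onb H i)‖ ^ 2 + ∑ i ∈ F, ‖D (onb H i)‖ ^ 2 + ε * F.card := by
          simp [Finset.sum_add_distrib, mul_comm]
      _ ≤ _ := by
          gcongr
          · exact (Summable.sum_le_tsum F (fun _ _ => by positivity) hCW).trans hCWM
          · exact Summable.sum_le_tsum F (fun _ _ => by positivity) hD
  -- The error `ε * F.card` disappears as `ε → 0` because `F` is fixed.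
  refine ge_of_tendsto (x := 𝓝[>] (0 : ℝ)) (f := fun ε =>
    M + ∑' i, ‖D (onb H i)‖ ^ 2 + ε * F.card) ?_ (eventually_mem_nhdsWithin.mono fun ε => key ε)
  have : Continuous fun ε : ℝ => M + ∑' i, ‖D (onb H i)‖ ^ 2 + ε * F.card := by fun_prop
  simpa using (this.tendsto 0).mono_left nhdsWithin_le_nhds

end TraceClass

/-! ### The identity `det e^M = e^{Tr M}`. -/

section DetExp

variable {n : Type*} [Fintype n] [DecidableEq n]

open scoped Matrix.Norms.Operator in
theorem hasDerivAt_exp_smul_apply (M : Matrix n n ℂ) (i j : n) :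
    HasDerivAt (fun t : ℂ => NormedSpace.exp (t • M) i j) (M i j) 0 := by
  have h := hasDerivAt_exp_smul_const' M (0 : ℂ)
  rw [zero_smul, NormedSpace.exp_zero, mul_one] at h
  let E : Matrix n n ℂ →L[ℂ] ℂ := LinearMap.toContinuousLinearMap
    { toFun := fun M => M i j, map_add' := fun _ _ => rfl, map_smul' := fun _ _ => rfl }
  exact E.hasFDerivAt.comp_hasDerivAt 0 h

theorem hasDerivAt_det_exp_smul_zero (M : Matrix n n ℂ) :
    HasDerivAt (fun t : ℂ => (NormedSpace.exp (t • M)).det) M.trace 0 := by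
  let f : ContinuousMultilinearMap ℂ (fun _ : n => n → ℂ) ℂ :=
    { (Matrix.detRowAlternating : (n → ℂ) [⋀^n]→ₗ[ℂ] ℂ).toMultilinearMap with
      cont := Continuous.matrix_det (A := fun M : Matrix n n ℂ => M) continuous_id }
  let N : ℂ → n → n → ℂ := fun t i j => (NormedSpace.exp (t • M) : Matrix n n ℂ) i j
  have hN : HasDerivAt N (fun i j => M i j) 0 :=
    hasDerivAt_pi.2 fun i => hasDerivAt_pi.2 fun j => hasDerivAt_exp_smul_apply M i j
  have h := (f.hasFDerivAt (x := N 0)).comp_hasDerivAt 0 hN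
  have h0 : N 0 = fun i j => (1 : Matrix n n ℂ) i j := by
    simp only [N, zero_smul, NormedSpace.exp_zero]
  have h1 : f.linearDeriv (N 0) (fun i j => M i j) = M.trace := by
    rw [h0, ContinuousMultilinearMap.linearDeriv_apply]
    refine Finset.sum_congr rfl fun i _ => ?_
    change (Matrix.updateRow 1 i (M i)).det = M i i
    rw [← Matrix.cramer_transpose_apply, Matrix.transpose_one, Matrix.cramer_one]
    rfl
  rw [h1] at h
  exact h

/-- The function `t ↦ det e^{tM} · e^{-t Tr M}` has zero derivative; the group law moves the
derivative at `s` to the one at `0`. -/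
theorem det_exp_eq_exp_trace (M : Matrix n n ℂ) :
    (NormedSpace.exp M).det = Complex.exp M.trace := by
  let g : ℂ → ℂ := fun t => (NormedSpace.exp (t • M)).det * Complex.exp (-(t * M.trace))
  have hadd : ∀ s t : ℂ, NormedSpace.exp ((s + t) • M) =
      NormedSpace.exp (s • M) * NormedSpace.exp (t • M) := fun s t => by
    rw [add_smul, Matrix.exp_add_of_commute]
    exact ((Commute.refl M).smul_left s).smul_right t
  have hd : ∀ s : ℂ, HasDerivAt g 0 s := fun s => by
    have h1 : HasDerivAt (fun t : ℂ => (NormedSpace.exp (t • M)).det)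
        ((NormedSpace.exp (s • M)).det * M.trace) s := by
      have h2 : HasDerivAt (fun t : ℂ => (NormedSpace.exp ((t - s) • M)).det) M.trace s := by
        refine HasDerivAt.comp_sub_const s s
          (f := fun t : ℂ => (NormedSpace.exp (t • M)).det) ?_
        rw [sub_self]
        exact hasDerivAt_det_exp_smul_zero M
      have h3 := h2.const_mul (NormedSpace.exp (s • M)).det
      refine h3.congr_of_eventuallyEq (Eventually.of_forall fun t => ?_)
      change _ = (NormedSpace.exp (s • M)).det * (NormedSpace.exp ((t - s) • M)).det
      rw [← Matrix.det_mul, ← hadd, add_sub_cancel]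
    have h4 : HasDerivAt (fun t : ℂ => Complex.exp (-(t * M.trace)))
        (Complex.exp (-(s * M.trace)) * (-(1 * M.trace))) s :=
      (((hasDerivAt_id s).mul_const M.trace).neg).cexp
    convert! h1.mul h4 using 1
    ring
  have hc := is_const_of_deriv_eq_zero (fun s => (hd s).differentiableAt)
    (fun s => (hd s).deriv) 1 0
  simp only [g, one_smul, zero_smul, NormedSpace.exp_zero, Matrix.det_one, one_mul, zero_mul,
    Complex.exp_zero, Complex.exp_neg, inv_one] at hc
  exact (mul_inv_eq_one₀ (Complex.exp_ne_zero _)).1 hc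

end DetExp

/-! ### The Fredholm determinant in an arbitrary orthonormal basis. -/

section Fredholm

variable {H K : Type*} [NormedAddCommGroup H] [InnerProductSpace ℂ H] [CompleteSpace H]
  [NormedAddCommGroup K] [InnerProductSpace ℂ K] [CompleteSpace K]
  {ι κ : Type*} (e : HilbertBasis ι ℂ H) (f : HilbertBasis κ ℂ H) {C D : H →L[ℂ] K}

/-- The matrix of an operator in an orthonormal basis. -/
def opMat (B : H →L[ℂ] H) : Matrix ι ι ℂ := Matrix.of fun i j => ⟪e i, B (e j)⟫_ℂ

theorem opMat_adjoint_comp :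
    opMat e (C.adjoint ∘L D) = Matrix.of fun i j => ⟪C (e i), D (e j)⟫_ℂ := by
  ext i j
  simp only [opMat, Matrix.of_apply, ContinuousLinearMap.comp_apply,
    ContinuousLinearMap.adjoint_inner_right]

theorem traceWedge_eq_tsum_minor (n : ℕ) (B : H →L[ℂ] H) :
    traceWedge n B = ∑' s : {s : Finset (BasisIndex H) // s.card = n},
      minor (opMat (onb H) B) s := by
  rw [traceWedge_eq_tsum_det]
  refine tsum_congr fun s => ?_
  rw [minor_eq_det_of_equiv _ _ (s.1.equivFinOfCardEq s.2).symm]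
  rfl

/-- Finite index sets are grouped by cardinality; the empty set supplies the leading `1`. -/
theorem fredholmDet_eq_fdet_of_summable {T : H →L[ℂ] H}
    (h : Summable fun s => minor (opMat (onb H) (T - 1)) s) :
    fredholmDet T = fdet (opMat (onb H) (T - 1)) := by
  set m := minor (opMat (onb H) (T - 1)) with hm
  let g := Equiv.sigmaFiberEquiv (Finset.card (α := BasisIndex H))
  have h1 : Summable fun p : Σ n, {s : Finset (BasisIndex H) // s.card = n} => m p.2 :=
    (g.summable_iff (f := m)).2 h
  have h2 : fdet (opMat (onb H) (T - 1)) = ∑' n, traceWedge n (T - 1) := by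
    simp_rw [traceWedge_eq_tsum_minor]
    exact (g.tsum_eq m).symm.trans h1.tsum_sigma
  have h3 : Summable fun n => traceWedge n (T - 1) := by
    simp_rw [traceWedge_eq_tsum_minor]
    exact h1.sigma
  have h4 : traceWedge 0 (T - 1) = 1 := by
    rw [traceWedge_eq_tsum_det, tsum_eq_single ⟨∅, rfl⟩]
    · simp
    · rintro ⟨s, hs⟩ hne
      exact absurd (Subtype.ext (Finset.card_eq_zero.1 hs)) hne
  rw [h2, h3.tsum_eq_zero_add, h4, fredholmDet]

theorem tsum_inner_mul_inner_apply (x y : K) :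
    ∑' i, ⟪x, D (e i)⟫_ℂ * ⟪C (e i), y⟫_ℂ = ⟪D.adjoint x, C.adjoint y⟫_ℂ := by
  rw [← e.tsum_inner_mul_inner]
  refine tsum_congr fun i => ?_
  rw [ContinuousLinearMap.adjoint_inner_left, ContinuousLinearMap.adjoint_inner_right]

/-- Both sides are limits of the same determinants, those of the sections of `1 + D C⋆` in a basis
of `K`. -/
theorem fdet_opMat_eq (hC : HS C) (hD : HS D) :
    fdet (opMat e (C.adjoint ∘L D)) = fdet (opMat f (C.adjoint ∘L D)) := by
  classical
  have he := tendsto_det_one_add_sylvester (onb K) (hC.summable_mul e hD)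
  have hf := tendsto_det_one_add_sylvester (onb K) (hC.summable_mul f hD)
  simp_rw [tsum_inner_mul_inner_apply] at he hf
  rw [opMat_adjoint_comp, opMat_adjoint_comp]
  exact tendsto_nhds_unique he hf

theorem fredholmDet_eq_fdet {T : H →L[ℂ] H} (hC : HS C) (hD : HS D)
    (hT : T - 1 = C.adjoint ∘L D) : fredholmDet T = fdet (opMat e (T - 1)) := by
  rw [fredholmDet_eq_fdet_of_summable, hT, fdet_opMat_eq _ e hC hD]
  rw [hT, opMat_adjoint_comp]
  exact (summable_minor_inner (hC.summable_mul (onb H) hD)).of_norm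

end Fredholm

/-! ### The quadratic remainder of `(1 - a) e^a`. -/

section Exp

theorem exists_exp_eq_one_add {𝔸 : Type*} [NormedRing 𝔸] [NormedAlgebra ℂ 𝔸] [CompleteSpace 𝔸]
    (a : 𝔸) : ∃ E : 𝔸, NormedSpace.exp a = 1 + a + a * E * a ∧ ‖E‖ ≤ ‖(1 : 𝔸)‖ + Real.exp ‖a‖ := by
  have hsum := NormedSpace.exp_series_hasSum_exp' (𝕂 := ℂ) a
  -- The term `n = 0` is kept apart: `‖a ^ 0‖ = ‖1‖` need not be at most `‖a‖ ^ 0`.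
  have hb : ∀ n : ℕ, ‖(((n + 2).factorial : ℂ)⁻¹) • a ^ n‖ ≤
      (if n = 0 then ‖(1 : 𝔸)‖ else 0) + ‖a‖ ^ n / n.factorial := fun n => by
    have h1 : ‖((n + 2).factorial : ℂ)⁻¹‖ ≤ (n.factorial : ℝ)⁻¹ := by
      rw [norm_inv, Complex.norm_natCast]
      gcongr
      omega
    have h2 : (n.factorial : ℝ)⁻¹ ≤ 1 := inv_le_one_of_one_le₀ (mod_cast n.factorial_pos)
    rw [norm_smul]
    rcases eq_or_ne n 0 with rfl | hn
    · simp only [pow_zero, if_true, Nat.factorial_zero, Nat.cast_one, div_one]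
      have : ‖((0 + 2).factorial : ℂ)⁻¹‖ * ‖(1 : 𝔸)‖ ≤ 1 * ‖(1 : 𝔸)‖ := by
        gcongr
        exact h1.trans h2
      linarith
    · rw [if_neg hn, zero_add, div_eq_inv_mul]
      gcongr
      exact norm_pow_le' a (Nat.pos_of_ne_zero hn)
  have hs : HasSum (fun n : ℕ => (if n = 0 then ‖(1 : 𝔸)‖ else 0) + ‖a‖ ^ n / n.factorial)
      (‖(1 : 𝔸)‖ + Real.exp ‖a‖) := by
    refine (hasSum_ite_eq 0 _).add ?_
    rw [Real.exp_eq_exp_ℝ]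
    exact NormedSpace.expSeries_div_hasSum_exp ‖a‖
  have hE : Summable fun n : ℕ => (((n + 2).factorial : ℂ)⁻¹) • a ^ n :=
    Summable.of_norm_bounded hs.summable hb
  refine ⟨∑' n : ℕ, (((n + 2).factorial : ℂ)⁻¹) • a ^ n, ?_, tsum_of_norm_bounded hs hb⟩
  have h1 := (hasSum_nat_add_iff' 2).2 hsum
  have h2 : HasSum (fun n : ℕ => a * ((((n + 2).factorial : ℂ)⁻¹) • a ^ n) * a) _ :=
    (hE.hasSum.mul_left a).mul_right a
  have h3 := h1.unique (h2.congr_fun fun n => by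
    rw [mul_smul_comm, smul_mul_assoc, ← pow_succ', ← pow_succ])
  rw [← h3]
  simp [Finset.sum_range_succ]

/-- The linear terms cancel, leaving a factor `a` on each side. The bound on `G` depends only on
`‖a‖` and `‖1‖`, hence is uniform over compressions. -/
theorem exists_one_sub_mul_exp {𝔸 : Type*} [NormedRing 𝔸] [NormedAlgebra ℂ 𝔸] [CompleteSpace 𝔸]
    (a : 𝔸) : ∃ G : 𝔸, (1 - a) * NormedSpace.exp a - 1 = a * (G * a) ∧
      ‖G‖ ≤ ‖(1 : 𝔸)‖ + (‖(1 : 𝔸)‖ + ‖a‖) * (‖(1 : 𝔸)‖ + Real.exp ‖a‖) := by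
  obtain ⟨E, hE, hn⟩ := exists_exp_eq_one_add a
  refine ⟨-1 + (1 - a) * E, by rw [hE]; noncomm_ring, ?_⟩
  refine (norm_add_le _ _).trans ?_
  rw [norm_neg]
  gcongr
  exact (norm_mul_le _ _).trans (mul_le_mul (norm_sub_le _ _) hn (norm_nonneg _) (by positivity))

end Exp

/-! ### The extended determinant as a limit of finite determinants. -/

section Compression

variable {H : Type*} [NormedAddCommGroup H] [InnerProductSpace ℂ H] [CompleteSpace H]
  {ι : Type*} [DecidableEq ι] (e : HilbertBasis ι ℂ H)

omit [CompleteSpace H] in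
theorem finSection_opMat_one (F : Finset ι) : finSection (opMat e 1) F = 1 := by
  ext i j
  have h := orthonormal_iff_ite.1 e.orthonormal i j
  simp only [finSection, opMat, Matrix.submatrix_apply, Matrix.of_apply, Matrix.one_apply,
    Subtype.ext_iff]
  exact h

omit [DecidableEq ι] in
theorem finSection_opMat_sub (A B : H →L[ℂ] H) (F : Finset ι) :
    finSection (opMat e (A - B)) F = finSection (opMat e A) F - finSection (opMat e B) F := by
  ext i j
  simp [finSection, opMat]

/-- Taking sections is not multiplicative in general; it is here because the compression factors
through the span of `F`. -/
theorem finSection_opMat_compression_mul (A X : H →L[ℂ] H) (F : Finset ι) :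
    finSection (opMat e (compression e A F * X)) F =
      finSection (opMat e A) F * finSection (opMat e X) F := by
  ext i j
  rw [Matrix.mul_apply]
  simp only [finSection, Matrix.submatrix_apply, opMat, Matrix.of_apply]
  rw [ContinuousLinearMap.mul_def, ContinuousLinearMap.comp_apply, compression_apply,
    ← inner_proj_left, proj_basis, if_pos i.2, proj_apply, map_sum, inner_sum,
    ← Finset.sum_coe_sort F]
  refine Finset.sum_congr rfl fun k _ => ?_
  rw [map_smul, inner_smul_right, mul_comm]

open scoped Matrix.Norms.Operator in
theorem finSection_opMat_exp (A : H →L[ℂ] H) (F : Finset ι) :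
    finSection (opMat e (NormedSpace.exp (compression e A F))) F =
      NormedSpace.exp (finSection (opMat e A) F) := by
  let Ψ : (H →L[ℂ] H) →+ Matrix F F ℂ :=
    { toFun := fun X => finSection (opMat e X) F
      map_zero' := by ext i j; simp [finSection, opMat]
      map_add' := fun X Y => by ext i j; simp [finSection, opMat] }
  have hΨ : Continuous Ψ := by
    refine continuous_matrix fun i j => ?_
    change Continuous fun X : H →L[ℂ] H => ⟪e i, X (e j)⟫_ℂ
    fun_prop
  have hsmul : ∀ (c : ℂ) X, Ψ (c • X) = c • Ψ X := fun c X => by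
    ext i j; simp [Ψ, finSection, opMat]
  have hpow : ∀ n : ℕ, Ψ (compression e A F ^ n) = finSection (opMat e A) F ^ n := fun n => by
    induction n with
    | zero =>
      rw [pow_zero, pow_zero]
      exact finSection_opMat_one e F
    | succ n ih =>
      rw [pow_succ', pow_succ', ← ih]
      exact finSection_opMat_compression_mul e A _ F
  have h1 := (NormedSpace.exp_series_hasSum_exp' (𝕂 := ℂ) (compression e A F)).map Ψ hΨ
  have h2 := NormedSpace.exp_series_hasSum_exp' (𝕂 := ℂ) (finSection (opMat e A) F)
  refine h1.unique (h2.congr_fun fun n => ?_)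
  rw [Function.comp_apply, hsmul, hpow]

theorem det_one_add_finSection_one_sub_mul_exp (A : H →L[ℂ] H) (F : Finset ι) :
    (1 + finSection (opMat e ((1 - compression e A F) * NormedSpace.exp (compression e A F) - 1))
      F).det = (1 - finSection (opMat e A) F).det *
        Complex.exp (finSection (opMat e A) F).trace := by
  rw [← det_exp_eq_exp_trace, ← Matrix.det_mul, finSection_opMat_sub, finSection_opMat_one,
    add_sub_cancel, sub_mul, one_mul, finSection_opMat_sub, finSection_opMat_compression_mul,
    finSection_opMat_exp, sub_mul, one_mul]

omit [DecidableEq ι] in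
theorem adjoint_compression (A : H →L[ℂ] H) (F : Finset ι) :
    (compression e A F).adjoint = compression e A.adjoint F := by
  symm
  rw [ContinuousLinearMap.eq_adjoint_iff]
  intro x y
  rw [compression_apply, compression_apply, inner_proj_left,
    ContinuousLinearMap.adjoint_inner_left, inner_proj_left]

/-- The sections belong to `A_F G_F A_F` with `A_F` the compression, so the minors are dominated
through `M ‖A⋆ eᵢ‖ ‖A eᵢ‖` for all `F` at once. -/
theorem tendsto_det_mul_exp_trace {A : H →L[ℂ] H} (hA : HS A) :
    Tendsto (fun F => (1 - finSection (opMat e A) F).det *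
        Complex.exp (finSection (opMat e A) F).trace) atTop
      (𝓝 (fredholmDet ((1 - A) * NormedSpace.exp A))) := by
  obtain ⟨G, hG, -⟩ := exists_one_sub_mul_exp A
  choose g hg hgn using fun F : Finset ι => exists_one_sub_mul_exp (compression e A F)
  have hT : (1 - A) * NormedSpace.exp A - 1 = A.adjoint.adjoint ∘L (G ∘L A) := by
    rw [ContinuousLinearMap.adjoint_adjoint]; exact hG
  have hTF : ∀ F, (1 - compression e A F) * NormedSpace.exp (compression e A F) - 1 =
      (compression e A.adjoint F).adjoint ∘L (g F ∘L compression e A F) := fun F => by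
    rw [← adjoint_compression, ContinuousLinearMap.adjoint_adjoint]; exact hg F
  rw [fredholmDet_eq_fdet e hA.adjoint (hA.comp_left G) hT]
  simp_rw [← det_one_add_finSection_one_sub_mul_exp, hTF, opMat_adjoint_comp]
  set M := ‖(1 : H →L[ℂ] H)‖ + (‖(1 : H →L[ℂ] H)‖ + ‖A‖) * (‖(1 : H →L[ℂ] H)‖ + Real.exp ‖A‖)
  have hM : ∀ F, ‖g F‖ ≤ M := fun F => (hgn F).trans (by
    have := norm_compression_le e A F
    have := Real.exp_le_exp.2 this
    dsimp only [M]
    gcongr)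
  have hM0 : 0 ≤ M := by positivity
  refine tendsto_det_one_add_finSection (x := fun F i => compression e A.adjoint F (e i))
    (y := fun F i => (g F ∘L compression e A F) (e i))
    (a := fun i => M * (‖A.adjoint (e i)‖ * ‖A (e i)‖)) (fun i => by positivity)
    ((hA.adjoint.summable_mul e hA).mul_left M) (Eventually.of_forall fun F i => ?_)
    (fun i j => ?_) tendsto_id
  · have h1 := norm_compression_basis_le e A.adjoint F i
    have h2 : ‖(g F ∘L compression e A F) (e i)‖ ≤ M * ‖A (e i)‖ :=
      ((g F).le_opNorm _).trans (mul_le_mul (hM F) (norm_compression_basis_le e A F i)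
        (norm_nonneg _) hM0)
    calc _ ≤ ‖A.adjoint (e i)‖ * (M * ‖A (e i)‖) := by gcongr
      _ = _ := by ring
  -- Entries converge since compressions converge in norm and the exponential is norm continuous.
  · have hc : Continuous fun X : H →L[ℂ] H =>
        ⟪e i, ((1 - X) * NormedSpace.exp X - 1) (e j)⟫_ℂ := by
      let _ : NormedAlgebra ℚ (H →L[ℂ] H) := NormedAlgebra.restrictScalars ℚ ℂ (H →L[ℂ] H)
      have h1 : Continuous fun X : H →L[ℂ] H => (1 - X) * NormedSpace.exp X - 1 :=
        ((continuous_const.sub continuous_id).mul NormedSpace.exp_continuous).sub continuous_const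
      fun_prop
    refine ((hc.tendsto A).comp (tendsto_compression e hA)).congr fun F => ?_
    rw [Function.comp_apply, hTF, ContinuousLinearMap.comp_apply,
      ContinuousLinearMap.adjoint_inner_right]

/-- The diagonal of `A` agrees with that of its even part, so the traces of the sections converge to
`Tr A_even`. The factors `e^{± Tr}` then cancel already at finite level. -/
theorem tendsto_det_extDet (H₁ : Submodule ℂ H) [CompleteSpace H₁] {A C D : H →L[ℂ] H}
    (hA : HS A) (hC : HS C) (hD : HS D) (hCD : evenPart H₁ A = C.adjoint ∘L D)
    (hdiag : ∀ i, ⟪e i, evenPart H₁ A (e i)⟫_ℂ = ⟪e i, A (e i)⟫_ℂ) :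
    Tendsto (fun F => (1 - finSection (opMat e A) F).det) atTop (𝓝 (extDet H₁ (1 - A))) := by
  have h1 := tendsto_det_mul_exp_trace e hA
  have hneg : evenPart H₁ (-A) = -evenPart H₁ A := by simp [evenPart, add_comm]
  have htr : trace (evenPart H₁ (-A)) = -∑' i, ⟪e i, A (e i)⟫_ℂ := by
    have h2 : ∀ i, ⟪C (e i), D (e i)⟫_ℂ = ⟪e i, A (e i)⟫_ℂ := fun i => by
      rw [← hdiag, hCD, ContinuousLinearMap.comp_apply, ContinuousLinearMap.adjoint_inner_right]
    have h3 : trace (evenPart H₁ A) = ∑' i, ⟪e i, A (e i)⟫_ℂ := by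
      rw [hCD, trace_adjoint_comp e hC hD, tsum_congr h2]
    rw [hneg, ← h3, trace, trace, ← tsum_neg]
    exact tsum_congr fun i => by simp
  have hs : HasSum (fun i => ⟪e i, A (e i)⟫_ℂ) (∑' i, ⟪e i, A (e i)⟫_ℂ) := by
    refine ((hC.summable_inner e hD).congr fun i => ?_).hasSum
    rw [← hdiag, hCD, ContinuousLinearMap.comp_apply, ContinuousLinearMap.adjoint_inner_right]
  have ht : Tendsto (fun F => Complex.exp (-(finSection (opMat e A) F).trace)) atTop
      (𝓝 (Complex.exp (trace (evenPart H₁ (-A))))) := by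
    rw [htr]
    have hs' : Tendsto (fun F : Finset ι => (finSection (opMat e A) F).trace) atTop
        (𝓝 (∑' i, ⟪e i, A (e i)⟫_ℂ)) :=
      Tendsto.congr (fun F => (Finset.sum_coe_sort F fun i => ⟪e i, A (e i)⟫_ℂ).symm) hs
    exact ((Complex.continuous_exp.comp continuous_neg).tendsto _).comp hs'
  have h4 := h1.mul ht
  have h5 : (1 : H →L[ℂ] H) - A - 1 = -A := by abel
  rw [extDet, h5, neg_neg]
  refine h4.congr fun F => ?_
  rw [mul_assoc, ← Complex.exp_add, add_neg_cancel, Complex.exp_zero, mul_one]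

end Compression

/-! ### Sums of Hilbert-Schmidt products. -/

section Pair

variable {H K L : Type*} [NormedAddCommGroup H] [InnerProductSpace ℂ H] [CompleteSpace H]
  [NormedAddCommGroup K] [InnerProductSpace ℂ K] [CompleteSpace K]
  [NormedAddCommGroup L] [InnerProductSpace ℂ L] [CompleteSpace L]

/-- The operator `x ↦ (S x, T x)` into the orthogonal direct sum. -/
def pairOp (S : H →L[ℂ] K) (T : H →L[ℂ] L) : H →L[ℂ] WithLp 2 (K × L) :=
  (WithLp.prodContinuousLinearEquiv 2 ℂ K L).symm.toContinuousLinearMap ∘L S.prod T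

theorem inner_pairOp (S S' : H →L[ℂ] K) (T T' : H →L[ℂ] L) (x y : H) :
    ⟪pairOp S T x, pairOp S' T' y⟫_ℂ = ⟪S x, S' y⟫_ℂ + ⟪T x, T' y⟫_ℂ :=
  WithLp.prod_inner_apply _ _

theorem norm_sq_pairOp (S : H →L[ℂ] K) (T : H →L[ℂ] L) (x : H) :
    ‖pairOp S T x‖ ^ 2 = ‖S x‖ ^ 2 + ‖T x‖ ^ 2 :=
  WithLp.prod_norm_sq_eq_of_L2 _

theorem HS.pairOp {S : H →L[ℂ] K} {T : H →L[ℂ] L} (hS : HS S) (hT : HS T) : HS (pairOp S T) := by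
  simp only [HS, norm_sq_pairOp]
  exact Summable.add hS hT

/-- A sum of two products thereby becomes a single product, the form required by the determinant
lemmas. -/
theorem adjoint_pairOp_comp (S S' : H →L[ℂ] K) (T T' : H →L[ℂ] L) :
    (pairOp S T).adjoint ∘L pairOp S' T' = S.adjoint ∘L S' + T.adjoint ∘L T' := by
  ext y
  refine ext_inner_left ℂ fun x => ?_
  simp only [ContinuousLinearMap.comp_apply, ContinuousLinearMap.adjoint_inner_right, inner_pairOp,
    add_apply, inner_add_right]

end Pair

/-! ### The Schur complement of finite sections and its limit. -/

section Schur

variable {K L : Type*} [NormedAddCommGroup K] [InnerProductSpace ℂ K] [CompleteSpace K]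
  [NormedAddCommGroup L] [InnerProductSpace ℂ L] [CompleteSpace L]
  {ι κ : Type*} [DecidableEq ι] [DecidableEq κ] (e : HilbertBasis ι ℂ K) (f : HilbertBasis κ ℂ L)
  {A₁₁ : K →L[ℂ] K} {A₁₂ : L →L[ℂ] K} {A₂₁ : K →L[ℂ] L} {A₂₂ : L →L[ℂ] L}

omit [DecidableEq ι] in
theorem tendsto_compression_apply {α : Type*} {l : Filter α} {F : α → Finset ι}
    (hF : Tendsto F l atTop) {R : α → K →L[ℂ] K} {R₀ : K →L[ℂ] K} (hR : Tendsto R l (𝓝 R₀)) (x : K) :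
    Tendsto (fun t => compression e (R t) (F t) x) l (𝓝 (R₀ x)) := by
  have h1 : Tendsto (fun t => R t (proj e (F t) x)) l (𝓝 (R₀ x)) :=
    (isBoundedBilinearMap_apply.continuous.tendsto (R₀, x)).comp
      (hR.prodMk_nhds ((tendsto_proj e x).comp hF))
  have h2 : Tendsto (fun t => proj e (F t) (R t (proj e (F t) x) - R₀ x)) l (𝓝 0) := by
    refine squeeze_zero_norm (fun t => norm_proj_apply_le e _ _) ?_
    exact tendsto_iff_norm_sub_tendsto_zero.1 h1
  have h3 := h2.add ((tendsto_proj e (R₀ x)).comp hF)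
  rw [zero_add] at h3
  refine h3.congr fun t => ?_
  rw [Function.comp_apply, map_sub, sub_add_cancel]
  rfl

/-- The matrix of an operator between two spaces, restricted to finitely many basis vectors. -/
def rectMat (T : L →L[ℂ] K) (F : Finset ι) (G : Finset κ) : Matrix F G ℂ :=
  Matrix.of fun i j => ⟪e i, T (f j)⟫_ℂ

omit [DecidableEq ι] [CompleteSpace K] [CompleteSpace L] in
theorem rectMat_comp_proj_comp {M μ : Type*} [NormedAddCommGroup M] [InnerProductSpace ℂ M]
    (g : HilbertBasis μ ℂ M) (S : K →L[ℂ] M) (T : L →L[ℂ] K) (Q : Finset μ) (F : Finset ι)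
    (G : Finset κ) :
    rectMat g f (S ∘L proj e F ∘L T) Q G = rectMat g e S Q F * rectMat e f T F G := by
  ext i j
  simp only [rectMat, Matrix.mul_apply, Matrix.of_apply, ContinuousLinearMap.comp_apply]
  rw [proj_apply, map_sum, inner_sum, ← Finset.sum_coe_sort F]
  refine Finset.sum_congr rfl fun k _ => ?_
  rw [map_smul, inner_smul_right, mul_comm]

omit [DecidableEq ι] in
theorem finSection_opMat_comp_compression_comp (S : K →L[ℂ] L) (X : K →L[ℂ] K) (T : L →L[ℂ] K)
    (F : Finset ι) (G : Finset κ) :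
    finSection (opMat f (S ∘L compression e X F ∘L T)) G =
      rectMat f e S G F * finSection (opMat e X) F * rectMat e f T F G := by
  rw [Matrix.mul_assoc]
  exact (rectMat_comp_proj_comp e f f S (X ∘L proj e F ∘L T) G F G).trans
    (congrArg _ (rectMat_comp_proj_comp e f e X T F F G))

omit [DecidableEq ι] [CompleteSpace K] in
theorem finSection_opMat_neg (X : K →L[ℂ] K) (F : Finset ι) :
    finSection (opMat e (-X)) F = -finSection (opMat e X) F := by
  ext i j
  simp [finSection, opMat]

/-- Since `1 - compression e A F` respects the splitting by `proj e F`, the section of its inverse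
inverts the section. -/
theorem finSection_resolvent_mul (A : K →L[ℂ] K) (hA : ‖A‖ < 1) (F : Finset ι) :
    (1 - finSection (opMat e A) F) *
      finSection (opMat e (Ring.inverse (1 - compression e A F))) F = 1 := by
  have hu : IsUnit (1 - compression e A F) :=
    isUnit_one_sub_of_norm_lt_one ((norm_compression_le e A F).trans_lt hA)
  rw [sub_mul, one_mul, ← finSection_opMat_compression_mul, ← finSection_opMat_sub,
    ← finSection_opMat_one e F]
  congr 2
  calc _ = (1 - compression e A F) * Ring.inverse (1 - compression e A F) := by
        rw [sub_mul, one_mul]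
    _ = 1 := Ring.mul_inverse_cancel _ hu

theorem det_fromBlocks_finSection (h₁₁ : ‖A₁₁‖ < 1) (F : Finset ι) (G : Finset κ) :
    (Matrix.fromBlocks (1 - finSection (opMat e A₁₁) F) (-rectMat e f A₁₂ F G)
      (-rectMat f e A₂₁ G F) (1 - finSection (opMat f A₂₂) G)).det =
    (1 - finSection (opMat e A₁₁) F).det *
      (1 - finSection (opMat f (A₂₂ + A₂₁ ∘L compression e
        (Ring.inverse (1 - compression e A₁₁ F)) F ∘L A₁₂)) G).det := by
  have hinv := finSection_resolvent_mul e A₁₁ h₁₁ F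
  let _ := invertibleOfRightInverse _ _ hinv
  have hadd : ∀ X Y : L →L[ℂ] L, finSection (opMat f (X + Y)) G =
      finSection (opMat f X) G + finSection (opMat f Y) G := fun X Y => by
    ext i j
    simp [finSection, opMat]
  rw [Matrix.det_fromBlocks₁₁, invOf_eq_right_inv hinv, hadd,
    finSection_opMat_comp_compression_comp, Matrix.neg_mul, Matrix.neg_mul, Matrix.mul_neg, neg_neg,
    sub_sub]

omit [DecidableEq ι] in
theorem tendsto_resolvent (h₁₁ : ‖A₁₁‖ < 1) (hHS : HS A₁₁) :
    Tendsto (fun F => Ring.inverse (1 - compression e A₁₁ F)) atTop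
      (𝓝 (Ring.inverse (1 - A₁₁))) := by
  obtain ⟨u, hu⟩ := isUnit_one_sub_of_norm_lt_one h₁₁
  have h := NormedRing.inverse_continuousAt u
  rw [hu] at h
  exact h.tendsto.comp (tendsto_const_nhds.sub (tendsto_compression e hHS))

theorem tendsto_det_one_sub_finSection {A : K →L[ℂ] K} {C D : K →L[ℂ] L} (hC : HS C) (hD : HS D)
    (hCD : A = C.adjoint ∘L D) : Tendsto (fun F => (1 - finSection (opMat e A) F).det) atTop
      (𝓝 (fredholmDet (1 - A))) := by
  have h1 : (1 : K →L[ℂ] K) - A - 1 = (-C).adjoint ∘L D := by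
    rw [map_neg, ContinuousLinearMap.neg_comp, ← hCD]; abel
  have h2 : (1 : K →L[ℂ] K) - A - 1 = -A := by abel
  rw [fredholmDet_eq_fdet e hC.neg hD h1]
  have := tendsto_det_one_add_finSection (l := atTop) (x := fun (_ : Finset ι) i => (-C) (e i))
    (y := fun _ i => D (e i)) (b := opMat e (1 - A - 1)) (fun i => by positivity)
    (hC.neg.summable_mul e hD) (Eventually.of_forall fun _ _ => le_rfl)
    (fun i j => by rw [h1, opMat_adjoint_comp]; exact tendsto_const_nhds) tendsto_id
  refine this.congr fun F => ?_
  rw [← opMat_adjoint_comp, ← h1, h2, finSection_opMat_neg, ← sub_eq_add_neg]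
  rfl

/-- The first factor is an ordinary finite-section limit. In the second the resolvent is that of a
compression; it varies with `p.1`, converges strongly and stays bounded, which suffices for
domination. -/
theorem tendsto_det_fromBlocks_finSection {M : Type*} [NormedAddCommGroup M] [InnerProductSpace ℂ M]
    [CompleteSpace M] (h₁₁ : ‖A₁₁‖ < 1) {C₁ D₁ : K →L[ℂ] M}
    (hC₁ : HS C₁) (hD₁ : HS D₁) (hCD₁ : A₁₁ = C₁.adjoint ∘L D₁) {C₂ D₂ : L →L[ℂ] M}
    (hC₂ : HS C₂) (hD₂ : HS D₂) (hCD₂ : A₂₂ = C₂.adjoint ∘L D₂) (h₁₂ : HS A₁₂) (h₂₁ : HS A₂₁) :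
    Tendsto (fun p : Finset ι × Finset κ =>
      (Matrix.fromBlocks (1 - finSection (opMat e A₁₁) p.1) (-rectMat e f A₁₂ p.1 p.2)
        (-rectMat f e A₂₁ p.2 p.1) (1 - finSection (opMat f A₂₂) p.2)).det) atTop
      (𝓝 (fredholmDet (1 - A₁₁) *
        fredholmDet (1 - A₂₂ - A₂₁ ∘L Ring.inverse (1 - A₁₁) ∘L A₁₂))) := by
  simp_rw [det_fromBlocks_finSection e f h₁₁]
  rw [← prod_atTop_atTop_eq]
  set R := Ring.inverse (1 - A₁₁) with hR
  let W : Finset ι → K →L[ℂ] K := fun F =>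
    compression e (Ring.inverse (1 - compression e A₁₁ F)) F
  have e2 : ∀ X : K →L[ℂ] K, -(A₂₂ + A₂₁ ∘L X ∘L A₁₂) =
      (pairOp (-C₂) (-A₂₁.adjoint)).adjoint ∘L pairOp D₂ (X ∘L A₁₂) := fun X => by
    rw [adjoint_pairOp_comp, map_neg, map_neg, ContinuousLinearMap.adjoint_adjoint,
      ContinuousLinearMap.neg_comp, ContinuousLinearMap.neg_comp, ← hCD₂]
    abel
  have e3 : (1 : L →L[ℂ] L) - A₂₂ - A₂₁ ∘L R ∘L A₁₂ - 1 = -(A₂₂ + A₂₁ ∘L R ∘L A₁₂) := by abel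
  have hC : HS (pairOp (-C₂) (-A₂₁.adjoint)) := hC₂.neg.pairOp h₂₁.adjoint.neg
  have hD : ∀ X : K →L[ℂ] K, HS (pairOp D₂ (X ∘L A₁₂)) := fun X => hD₂.pairOp (h₁₂.comp_left X)
  have hHS : HS A₁₁ := by rw [hCD₁]; exact hD₁.comp_left _
  refine ((tendsto_det_one_sub_finSection e hC₁ hD₁ hCD₁).comp tendsto_fst).mul ?_
  · rw [fredholmDet_eq_fdet f hC (hD R) (e3.trans (e2 R)), e3, e2]
    have hWlim : ∀ x, Tendsto (fun p : Finset ι × Finset κ => W p.1 x) (atTop ×ˢ atTop) (𝓝 (R x)) :=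
      fun x => tendsto_compression_apply e tendsto_fst
        ((tendsto_resolvent e h₁₁ hHS).comp tendsto_fst) x
    -- The `+ 1` leaves room: the resolvent norms tend to `‖R‖` and are eventually below `‖R‖ + 1`.
    have hWbd : ∀ᶠ p : Finset ι × Finset κ in atTop ×ˢ atTop, ‖W p.1‖ ≤ ‖R‖ + 1 := by
      have h1 := ((tendsto_resolvent e h₁₁ hHS).comp
        (tendsto_fst (f := atTop) (g := (atTop : Filter (Finset κ))))).norm
      filter_upwards [h1.eventually (ge_mem_nhds (lt_add_one ‖R‖))] with p hp
      exact (norm_compression_le e _ _).trans hp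
    have := tendsto_det_one_add_finSection (l := atTop ×ˢ atTop)
      (x := fun (_ : Finset ι × Finset κ) i => pairOp (-C₂) (-A₂₁.adjoint) (f i))
      (y := fun p i => pairOp D₂ (W p.1 ∘L A₁₂) (f i))
      (b := opMat f ((pairOp (-C₂) (-A₂₁.adjoint)).adjoint ∘L pairOp D₂ (R ∘L A₁₂)))
      (a := fun i => ‖pairOp (-C₂) (-A₂₁.adjoint) (f i)‖ ^ 2 +
        (‖D₂ (f i)‖ ^ 2 + (‖R‖ + 1) ^ 2 * ‖A₁₂ (f i)‖ ^ 2))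
      (fun i => by positivity)
      ((hC.summable f).add ((hD₂.summable f).add ((h₁₂.summable f).mul_left _)))
      (hWbd.mono fun p hp i => ?_) (fun i j => ?_) tendsto_snd
    · refine this.congr fun p => ?_
      rw [← opMat_adjoint_comp, ← e2, finSection_opMat_neg, ← sub_eq_add_neg]
    · have h1 : ‖pairOp D₂ (W p.1 ∘L A₁₂) (f i)‖ ^ 2 ≤
          ‖D₂ (f i)‖ ^ 2 + (‖R‖ + 1) ^ 2 * ‖A₁₂ (f i)‖ ^ 2 := by
        rw [norm_sq_pairOp, ← mul_pow]
        gcongr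
        exact ((W p.1).le_opNorm _).trans (mul_le_mul_of_nonneg_right hp (norm_nonneg _))
      nlinarith [sq_nonneg (‖pairOp (-C₂) (-A₂₁.adjoint) (f i)‖ -
        ‖pairOp D₂ (W p.1 ∘L A₁₂) (f i)‖), sq_nonneg ‖pairOp (-C₂) (-A₂₁.adjoint) (f i)‖,
        sq_nonneg ‖pairOp D₂ (W p.1 ∘L A₁₂) (f i)‖]
    · simp only [opMat_adjoint_comp, Matrix.of_apply, inner_pairOp]
      exact tendsto_const_nhds.add (tendsto_const_nhds.inner (hWlim _))

end Schur

/-! ### Orthonormal bases adapted to the splitting. -/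

section Splitting

variable {H : Type*} [NormedAddCommGroup H] [InnerProductSpace ℂ H] [CompleteSpace H]
  (H₁ : Submodule ℂ H) [CompleteSpace H₁] {ι κ : Type*}
  (e : HilbertBasis ι ℂ H₁) (f : HilbertBasis κ ℂ H₁ᗮ)

theorem orthonormal_sumElim :
    Orthonormal ℂ (Sum.elim (fun i => (e i : H)) fun k => (f k : H)) := by
  constructor
  · rintro (i | k)
    · exact norm_basis e i
    · exact norm_basis f k
  · rintro (i | k) (j | l) h
    · exact e.orthonormal.2 fun h' => h (congrArg _ h')
    · exact (f l).2 _ (e i).2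
    · exact inner_eq_zero_symm.1 ((f k).2 _ (e j).2)
    · exact f.orthonormal.2 fun h' => h (congrArg _ h')

theorem eq_zero_of_inner_basis {K : Type*} [NormedAddCommGroup K] [InnerProductSpace ℂ K]
    {μ : Type*} (g : HilbertBasis μ ℂ K) {x : K} (h : ∀ i, ⟪g i, x⟫_ℂ = 0) : x = 0 := by
  have h1 := hasSum_norm_inner_sq g x
  simp only [h, norm_zero, ne_eq, OfNat.ofNat_ne_zero, not_false_eq_true, zero_pow] at h1
  simpa using h1.unique hasSum_zero

theorem orthogonal_span_sumElim :
    (Submodule.span ℂ (Set.range (Sum.elim (fun i => (e i : H)) fun k => (f k : H))))ᗮ = ⊥ := by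
  rw [Submodule.eq_bot_iff]
  intro x hx
  have h : ∀ p, ⟪Sum.elim (fun i => (e i : H)) (fun k => (f k : H)) p, x⟫_ℂ = 0 := fun p =>
    hx _ (Submodule.subset_span ⟨p, rfl⟩)
  have h1 : H₁.orthogonalProjectionOnto x = 0 := eq_zero_of_inner_basis e fun i => by
    rw [Submodule.inner_orthogonalProjectionOnto_eq_of_mem_left]
    exact h (Sum.inl i)
  have h2 : H₁ᗮ.orthogonalProjectionOnto x = 0 := eq_zero_of_inner_basis f fun k => by
    rw [Submodule.inner_orthogonalProjectionOnto_eq_of_mem_left]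
    exact h (Sum.inr k)
  rw [← H₁.starProjection_add_starProjection_orthogonal x, Submodule.starProjection_apply,
    Submodule.starProjection_apply, h1, h2]
  simp

/-- The orthonormal basis of `H` composed of orthonormal bases of `H₁` and of `H₁ᗮ`. -/
def splitBasis : HilbertBasis (ι ⊕ κ) ℂ H :=
  HilbertBasis.mkOfOrthogonalEqBot (orthonormal_sumElim H₁ e f) (orthogonal_span_sumElim H₁ e f)

theorem splitBasis_inl (i : ι) : splitBasis H₁ e f (Sum.inl i) = e i := by
  rw [splitBasis, HilbertBasis.coe_mkOfOrthogonalEqBot]; rfl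

theorem splitBasis_inr (k : κ) : splitBasis H₁ e f (Sum.inr k) = f k := by
  rw [splitBasis, HilbertBasis.coe_mkOfOrthogonalEqBot]; rfl

theorem inner_block (K L : Submodule ℂ H) [CompleteSpace K] (A : H →L[ℂ] H) (x : K) (y : L) :
    ⟪x, block K L A y⟫_ℂ = ⟪(x : H), A y⟫_ℂ :=
  Submodule.inner_orthogonalProjectionOnto_eq_of_mem_left _ _

theorem det_one_sub_finSection_disjSum [DecidableEq ι] [DecidableEq κ] (A : H →L[ℂ] H)
    (F : Finset ι) (G : Finset κ) :
    (1 - finSection (opMat (splitBasis H₁ e f) A) (F.disjSum G)).det =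
      (Matrix.fromBlocks (1 - finSection (opMat e (block H₁ H₁ A)) F)
        (-rectMat e f (block H₁ H₁ᗮ A) F G) (-rectMat f e (block H₁ᗮ H₁ A) G F)
        (1 - finSection (opMat f (block H₁ᗮ H₁ᗮ A)) G)).det := by
  let g : F ⊕ G ≃ (F.disjSum G : Finset (ι ⊕ κ)) :=
    { toFun := Sum.elim (fun i => ⟨Sum.inl i, Finset.inl_mem_disjSum.2 i.2⟩)
        (fun k => ⟨Sum.inr k, Finset.inr_mem_disjSum.2 k.2⟩)
      invFun := fun p => match p with
        | ⟨Sum.inl i, h⟩ => Sum.inl ⟨i, Finset.inl_mem_disjSum.1 h⟩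
        | ⟨Sum.inr k, h⟩ => Sum.inr ⟨k, Finset.inr_mem_disjSum.1 h⟩
      left_inv := by rintro (i | k) <;> rfl
      right_inv := by rintro ⟨i | k, h⟩ <;> rfl }
  rw [← Matrix.det_submatrix_equiv_self g]
  congr 1
  ext (i | k) (j | l)
  all_goals simp only [g, finSection, opMat, rectMat, splitBasis_inl, splitBasis_inr, inner_block,
    Matrix.one_apply, Matrix.submatrix_apply, Matrix.sub_apply, Matrix.neg_apply, Matrix.of_apply,
    Matrix.fromBlocks_apply₁₁, Matrix.fromBlocks_apply₁₂, Matrix.fromBlocks_apply₂₁,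
    Matrix.fromBlocks_apply₂₂, Equiv.coe_fn_mk, Sum.elim_inl, Sum.elim_inr, Subtype.mk.injEq,
    Sum.inl.injEq, Sum.inr.injEq, SetLike.coe_eq_coe, reduceCtorEq, if_false, zero_sub]

theorem tendsto_disjSum : Tendsto (fun p : Finset ι × Finset κ => p.1.disjSum p.2) atTop atTop := by
  classical
  refine tendsto_atTop_finset_of_monotone
    (fun p q h => Finset.disjSum_mono h.1 h.2) ?_
  rintro (i | k)
  · exact ⟨({i}, ∅), by simp⟩
  · exact ⟨(∅, {k}), by simp⟩

end Splitting

/-! ### A lower bound for determinants of Hermitian matrices. -/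

section HermitianMatrix

variable {n : Type*} [Fintype n] [DecidableEq n] {M : Matrix n n ℂ}

/-- From `log u ≥ 1 - 1/u` at `u = 1 - t`, which gives `-t - t² / (1 - t)`. -/
theorem exp_neg_sub_sq_le_one_sub {q t : ℝ} (hq : q < 1) (ht : t ≤ q) :
    Real.exp (-t - (1 - q)⁻¹ * t ^ 2) ≤ 1 - t := by
  have h1 : 0 < 1 - t := by linarith
  have h2 := Real.one_sub_inv_le_log_of_pos h1
  have h3 : (1 - t)⁻¹ ≤ (1 - q)⁻¹ := inv_anti₀ (by linarith) (by linarith)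
  have h4 : 1 - (1 - t)⁻¹ = -t - (1 - t)⁻¹ * t ^ 2 := by
    field_simp
    ring
  rw [← Real.le_log_iff_exp_le h1]
  nlinarith [mul_le_mul_of_nonneg_right h3 (sq_nonneg t)]

theorem sum_eigenvalues_sq (hM : M.IsHermitian) :
    ∑ i, hM.eigenvalues i ^ 2 = ∑ i, ∑ j, ‖M i j‖ ^ 2 := by
  have h1 : (M * M).trace = ((∑ i, hM.eigenvalues i ^ 2 : ℝ) : ℂ) := by
    conv_lhs => rw [hM.spectral_theorem, ← map_mul, Unitary.conjStarAlgAut_apply,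
      Matrix.trace_mul_cycle, Unitary.coe_star_mul_self, one_mul, Matrix.diagonal_mul_diagonal,
      Matrix.trace_diagonal]
    simp [sq]
  have h2 : (M * M).trace = ((∑ i, ∑ j, ‖M i j‖ ^ 2 : ℝ) : ℂ) := by
    simp only [Matrix.trace, Matrix.diag_apply, Matrix.mul_apply]
    push_cast
    refine Finset.sum_congr rfl fun i _ => Finset.sum_congr rfl fun j _ => ?_
    rw [← hM.apply j i]
    exact Complex.mul_conj' (M i j)
  exact_mod_cast h1.symm.trans h2

theorem det_one_sub_eq_prod_eigenvalues (hM : M.IsHermitian) :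
    (1 - M).det = ((∏ i, (1 - hM.eigenvalues i) : ℝ) : ℂ) := by
  have h := congrArg (Polynomial.eval 1) hM.charpoly_eq
  rw [Matrix.eval_charpoly, Polynomial.eval_prod, map_one] at h
  rw [h]
  simp

/-- The scalar bound is multiplied over the eigenvalues. Only the trace and the sum of squared
entries remain, and both are controlled uniformly over finite sections. -/
theorem exp_le_det_one_sub (hM : M.IsHermitian) {q : ℝ} (hq : q < 1)
    (hle : ∀ v : n → ℂ, (dotProduct (star v) (M.mulVec v)).re ≤ q * ∑ i, ‖v i‖ ^ 2) :
    (1 - M).det.im = 0 ∧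
      Real.exp (-M.trace.re - (1 - q)⁻¹ * ∑ i, ∑ j, ‖M i j‖ ^ 2) ≤ (1 - M).det.re := by
  have hev : ∀ i, hM.eigenvalues i ≤ q := fun i => by
    have h := hle (hM.eigenvectorBasis i)
    have h1 : ∑ k, ‖hM.eigenvectorBasis i k‖ ^ 2 = 1 := by
      rw [← EuclideanSpace.norm_sq_eq, hM.eigenvectorBasis.norm_eq_one, one_pow]
    rw [h1, mul_one] at h
    rw [hM.eigenvalues_eq]
    exact h
  rw [det_one_sub_eq_prod_eigenvalues hM, Complex.ofReal_im, Complex.ofReal_re]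
  refine ⟨rfl, ?_⟩
  have ht : M.trace.re = ∑ i, hM.eigenvalues i := by
    rw [hM.trace_eq_sum_eigenvalues]
    simp
  rw [ht, ← sum_eigenvalues_sq hM, Finset.mul_sum, ← Finset.sum_neg_distrib,
    ← Finset.sum_sub_distrib, Real.exp_sum]
  exact Finset.prod_le_prod (fun _ _ => (Real.exp_pos _).le) fun i _ =>
    exp_neg_sub_sq_le_one_sub hq (hev i)

end HermitianMatrix

/-! ### Positivity of Fredholm determinants. -/

section Positivity

variable {K : Type*} [NormedAddCommGroup K] [InnerProductSpace ℂ K] [CompleteSpace K]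
  {M : Type*} [NormedAddCommGroup M] [InnerProductSpace ℂ M] [CompleteSpace M]

theorem fredholmDet_one_sub_pos {B : K →L[ℂ] K} {C D : K →L[ℂ] M} (hB : IsSelfAdjoint B) (hC : HS C) (hD : HS D)
    (hCD : B = C.adjoint ∘L D) {q : ℝ} (hq : q < 1) (hle : ∀ x, (⟪x, B x⟫_ℂ).re ≤ q * ‖x‖ ^ 2) :
    (fredholmDet (1 - B)).im = 0 ∧ 0 < (fredholmDet (1 - B)).re := by
  classical
  set e := onb K
  have hlim := tendsto_det_one_sub_finSection e hC hD hCD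
  have hBHS : HS B := by rw [hCD]; exact hD.comp_left _
  have hherm : ∀ F, (finSection (opMat e B) F).IsHermitian := fun F => by
    ext i j
    simp only [finSection, opMat, Matrix.conjTranspose_apply, Matrix.submatrix_apply,
      Matrix.of_apply]
    rw [← starRingEnd_apply, inner_conj_symm]
    nth_rw 1 [← hB.star_eq]
    rw [ContinuousLinearMap.star_eq_adjoint, ContinuousLinearMap.adjoint_inner_left]
  have hquad : ∀ (F : Finset (BasisIndex K)) (v : F → ℂ),
      (dotProduct (star v) ((finSection (opMat e B) F).mulVec v)).re ≤ q * ∑ i, ‖v i‖ ^ 2 := by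
    intro F v
    have ho : Orthonormal ℂ fun i : F => e i := e.orthonormal.comp _ Subtype.val_injective
    have h := hle (∑ i, v i • e i)
    have h1 : ⟪∑ i, v i • e i, B (∑ i, v i • e i)⟫_ℂ =
        dotProduct (star v) ((finSection (opMat e B) F).mulVec v) := by
      simp only [map_sum, map_smul, sum_inner, inner_sum, inner_smul_left, inner_smul_right,
        dotProduct, Matrix.mulVec, finSection, opMat, Matrix.submatrix_apply, Matrix.of_apply,
        Pi.star_apply, Finset.mul_sum]
      rw [Finset.sum_comm]
      refine Finset.sum_congr rfl fun i _ => Finset.sum_congr rfl fun j _ => ?_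
      rw [← starRingEnd_apply]
      ring
    have h2 : ‖∑ i, v i • e i‖ ^ 2 = ∑ i, ‖v i‖ ^ 2 := by
      have h3 : ((‖∑ i, v i • e i‖ ^ 2 : ℝ) : ℂ) = ((∑ i, ‖v i‖ ^ 2 : ℝ) : ℂ) := by
        push_cast
        have h4 := inner_self_eq_norm_sq_to_K (𝕜 := ℂ) (∑ i, v i • e i)
        rw [ho.inner_sum] at h4
        refine h4.symm.trans (Finset.sum_congr rfl fun i _ => ?_)
        exact Complex.conj_mul' (v i)
      exact_mod_cast h3
    rwa [h1, h2] at h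
  have hbd := fun F => exp_le_det_one_sub (hherm F) hq (hquad F)
  set T := ∑' i, ‖C (e i)‖ * ‖D (e i)‖
  set S := ∑' i, ‖B (e i)‖ ^ 2
  have hT : ∀ F, (finSection (opMat e B) F).trace.re ≤ T := fun F => by
    have h1 : (finSection (opMat e B) F).trace = ∑ i ∈ F, ⟪C (e i), D (e i)⟫_ℂ := by
      rw [← Finset.sum_coe_sort F, hCD, opMat_adjoint_comp]
      rfl
    rw [h1]
    refine (Complex.re_le_norm _).trans ((norm_sum_le _ _).trans ?_)
    refine (Finset.sum_le_sum fun i _ => norm_inner_le_norm _ _).trans ?_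
    exact (hC.summable_mul e hD).sum_le_tsum F fun _ _ => by positivity
  have hS : ∀ F, ∑ i, ∑ j, ‖finSection (opMat e B) F i j‖ ^ 2 ≤ S := fun F => by
    rw [Finset.sum_comm]
    -- Bessel's inequality, column by column.
    calc _ ≤ ∑ j : F, ‖B (e j)‖ ^ 2 := Finset.sum_le_sum fun j _ => by
          refine le_trans (le_of_eq ?_) (e.orthonormal.sum_inner_products_le (s := F) (B (e j)))
          exact Finset.sum_coe_sort F fun i => ‖⟪e i, B (e j)⟫_ℂ‖ ^ 2
      _ = ∑ j ∈ F, ‖B (e j)‖ ^ 2 := Finset.sum_coe_sort F fun j => ‖B (e j)‖ ^ 2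
      _ ≤ S := (hBHS.summable e).sum_le_tsum F fun _ _ => by positivity
  have hq' : 0 ≤ (1 - q)⁻¹ := inv_nonneg.2 (by linarith)
  constructor
  · refine tendsto_nhds_unique ((Complex.continuous_im.tendsto _).comp hlim) ?_
    exact tendsto_const_nhds.congr fun F => ((hbd F).1).symm
  · refine (Real.exp_pos (-T - (1 - q)⁻¹ * S)).trans_le ?_
    refine ge_of_tendsto' ((Complex.continuous_re.tendsto _).comp hlim) fun F => ?_
    refine le_trans (Real.exp_le_exp.2 ?_) (hbd F).2
    have := mul_le_mul_of_nonneg_left (hS F) hq'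
    linarith [hT F]

end Positivity

/-! ### Blocks of `J`-self-adjoint operators. -/

section Blocks

variable {H : Type*} [NormedAddCommGroup H] [InnerProductSpace ℂ H] [CompleteSpace H]
  {H₁ : Submodule ℂ H} [CompleteSpace H₁] {A : H →L[ℂ] H}

theorem starProjection_coe_self (K : Submodule ℂ H) [K.HasOrthogonalProjection] (x : K) :
    K.starProjection x = x := Submodule.starProjection_eq_self_iff.2 x.2

theorem starProjection_orthogonal_coe (x : H₁) : H₁ᗮ.starProjection (x : H) = 0 :=
  (Submodule.starProjection_apply_eq_zero_iff _).2 (H₁.le_orthogonal_orthogonal x.2)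

theorem starProjection_coe_orthogonal (x : H₁ᗮ) : H₁.starProjection (x : H) = 0 :=
  (Submodule.starProjection_apply_eq_zero_iff _).2 x.2

theorem inner_evenPart_left (x : H₁) (y : H) :
    ⟪(x : H), evenPart H₁ A y⟫_ℂ = ⟪(x : H), A (H₁.starProjection y)⟫_ℂ := by
  simp only [evenPart, add_apply, ContinuousLinearMap.mul_def, ContinuousLinearMap.comp_apply,
    inner_add_right]
  rw [← Submodule.inner_starProjection_left_eq_right, ← Submodule.inner_starProjection_left_eq_right,
    starProjection_coe_self, starProjection_orthogonal_coe, inner_zero_left, add_zero]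

theorem inner_evenPart_right (x : H₁ᗮ) (y : H) :
    ⟪(x : H), evenPart H₁ A y⟫_ℂ = ⟪(x : H), A (H₁ᗮ.starProjection y)⟫_ℂ := by
  simp only [evenPart, add_apply, ContinuousLinearMap.mul_def, ContinuousLinearMap.comp_apply,
    inner_add_right]
  rw [← Submodule.inner_starProjection_left_eq_right, ← Submodule.inner_starProjection_left_eq_right,
    starProjection_coe_self, starProjection_coe_orthogonal, inner_zero_left, zero_add]

theorem evenPart_add_oddPart : evenPart H₁ A + oddPart H₁ A = A := by
  ext x
  simp only [evenPart, oddPart, add_apply, ContinuousLinearMap.mul_def,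
    ContinuousLinearMap.comp_apply]
  set P := H₁.starProjection
  set Q := H₁ᗮ.starProjection
  have h : ∀ y, P y + Q y = y := H₁.starProjection_add_starProjection_orthogonal
  calc P (A (P x)) + Q (A (Q x)) + (P (A (Q x)) + Q (A (P x)))
      = P (A (P x + Q x)) + Q (A (P x + Q x)) := by simp only [map_add]; abel
    _ = A x := by rw [h, h]

theorem block_evenPart_left : block H₁ H₁ (evenPart H₁ A) = block H₁ H₁ A := by
  ext y : 1
  refine ext_inner_left ℂ fun x => ?_
  rw [inner_block, inner_block, inner_evenPart_left, starProjection_coe_self]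

theorem block_evenPart_right : block H₁ᗮ H₁ᗮ (evenPart H₁ A) = block H₁ᗮ H₁ᗮ A := by
  ext y : 1
  refine ext_inner_left ℂ fun x => ?_
  rw [inner_block, inner_block, inner_evenPart_right, starProjection_coe_self]

theorem block_add (K L : Submodule ℂ H) [CompleteSpace K] (A B : H →L[ℂ] H) :
    block K L (A + B) = block K L A + block K L B := by
  ext y : 1
  simp [block]

theorem block_oddPart_left : block H₁ H₁ᗮ (oddPart H₁ A) = block H₁ H₁ᗮ A := by
  conv_rhs => rw [← evenPart_add_oddPart (H₁ := H₁) (A := A), block_add]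
  have : block H₁ H₁ᗮ (evenPart H₁ A) = 0 := by
    ext y : 1
    refine ext_inner_left ℂ fun x => ?_
    rw [inner_block, inner_evenPart_left, starProjection_coe_orthogonal]
    simp
  rw [this, zero_add]

theorem block_oddPart_right : block H₁ᗮ H₁ (oddPart H₁ A) = block H₁ᗮ H₁ A := by
  conv_rhs => rw [← evenPart_add_oddPart (H₁ := H₁) (A := A), block_add]
  have : block H₁ᗮ H₁ (evenPart H₁ A) = 0 := by
    ext y : 1
    refine ext_inner_left ℂ fun x => ?_
    rw [inner_block, inner_evenPart_right, starProjection_orthogonal_coe]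
    simp
  rw [this, zero_add]

theorem HS.block {A : H →L[ℂ] H} (hA : HS A) (K L : Submodule ℂ H) [CompleteSpace K]
    [CompleteSpace L] : HS (block K L A) :=
  (hA.comp_right L.subtypeL).comp_left K.orthogonalProjectionOnto

theorem norm_block_le (K L : Submodule ℂ H) [CompleteSpace K] (A : H →L[ℂ] H) :
    ‖block K L A‖ ≤ ‖A‖ :=
  ContinuousLinearMap.opNorm_le_bound _ (norm_nonneg _) fun x =>
    (K.norm_orthogonalProjectionOnto_apply_le _).trans (A.le_opNorm x)

theorem block_adjoint_comp (K : Submodule ℂ H) [CompleteSpace K] (C D : H →L[ℂ] H) :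
    block K K (C.adjoint ∘L D) = (C ∘L K.subtypeL).adjoint ∘L (D ∘L K.subtypeL) := by
  ext y : 1
  refine ext_inner_left ℂ fun x => ?_
  rw [inner_block, ContinuousLinearMap.comp_apply, ContinuousLinearMap.adjoint_inner_right,
    ContinuousLinearMap.comp_apply, ContinuousLinearMap.adjoint_inner_right]
  rfl

theorem inner_J_left (x : H₁) (y : H) : ⟪J H₁ y, (x : H)⟫_ℂ = ⟪y, (x : H)⟫_ℂ := by
  rw [J, sub_apply, inner_sub_left, Submodule.inner_starProjection_left_eq_right,
    Submodule.inner_starProjection_left_eq_right, starProjection_coe_self,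
    starProjection_orthogonal_coe, inner_zero_right, sub_zero]

theorem inner_J_right (x : H₁ᗮ) (y : H) : ⟪J H₁ y, (x : H)⟫_ℂ = -⟪y, (x : H)⟫_ℂ := by
  rw [J, sub_apply, inner_sub_left, Submodule.inner_starProjection_left_eq_right,
    Submodule.inner_starProjection_left_eq_right, starProjection_coe_self,
    starProjection_coe_orthogonal, inner_zero_right, zero_sub]

theorem J_coe_left (x : H₁) : J H₁ (x : H) = x := by
  rw [J, sub_apply, starProjection_coe_self, starProjection_orthogonal_coe, sub_zero]

theorem J_coe_right (x : H₁ᗮ) : J H₁ (x : H) = -x := by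
  rw [J, sub_apply, starProjection_coe_self, starProjection_coe_orthogonal, zero_sub]

theorem isSelfAdjoint_of_inner {K : Type*} [NormedAddCommGroup K] [InnerProductSpace ℂ K]
    [CompleteSpace K] {B : K →L[ℂ] K} (h : ∀ x y, ⟪B x, y⟫_ℂ = ⟪x, B y⟫_ℂ) : IsSelfAdjoint B :=
  ContinuousLinearMap.isSelfAdjoint_iff_isSymmetric.2 h

theorem IsJSelfAdjoint.inner_left (hJ : IsJSelfAdjoint H₁ A) (x y : H₁) :
    ⟪A x, (y : H)⟫_ℂ = ⟪(x : H), A y⟫_ℂ := by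
  rw [← inner_J_left, hJ, J_coe_left]

theorem IsJSelfAdjoint.inner_right (hJ : IsJSelfAdjoint H₁ A) (x y : H₁ᗮ) :
    ⟪A x, (y : H)⟫_ℂ = ⟪(x : H), A y⟫_ℂ := by
  have h := hJ x y
  rwa [inner_J_right, J_coe_right, inner_neg_left, neg_inj] at h

theorem IsJSelfAdjoint.block_left (hJ : IsJSelfAdjoint H₁ A) : IsSelfAdjoint (block H₁ H₁ A) :=
  isSelfAdjoint_of_inner fun x y => by
    rw [inner_block, ← hJ.inner_left, ← inner_conj_symm, inner_block, inner_conj_symm]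

theorem IsJSelfAdjoint.block_right (hJ : IsJSelfAdjoint H₁ A) :
    IsSelfAdjoint (block H₁ᗮ H₁ᗮ A) :=
  isSelfAdjoint_of_inner fun x y => by
    rw [inner_block, ← hJ.inner_right, ← inner_conj_symm, inner_block, inner_conj_symm]

/-- The sign arises because `J` is `1` on `H₁` and `-1` on `H₁ᗮ`. -/
theorem IsJSelfAdjoint.block_offDiag (hJ : IsJSelfAdjoint H₁ A) :
    block H₁ᗮ H₁ A = -(block H₁ H₁ᗮ A).adjoint := by
  ext y : 1
  refine ext_inner_left ℂ fun x => ?_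
  have h := hJ x y
  rw [inner_J_left, J_coe_right, inner_neg_left] at h
  rw [neg_apply, inner_neg_right, ContinuousLinearMap.adjoint_inner_right,
    ← inner_conj_symm (block H₁ H₁ᗮ A x), inner_block, inner_block, inner_conj_symm, h, neg_neg]

theorem IsJSelfAdjoint.evenPart (hJ : IsJSelfAdjoint H₁ A) : IsSelfAdjoint (evenPart H₁ A) :=
  isSelfAdjoint_of_inner fun x y => by
    have h1 := hJ.inner_left (H₁.orthogonalProjectionOnto x) (H₁.orthogonalProjectionOnto y)
    have h2 := hJ.inner_right (H₁ᗮ.orthogonalProjectionOnto x) (H₁ᗮ.orthogonalProjectionOnto y)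
    simp only [← Submodule.starProjection_apply] at h1 h2
    simp only [ExtFredholm.evenPart, add_apply, ContinuousLinearMap.mul_def,
      ContinuousLinearMap.comp_apply, inner_add_left, inner_add_right,
      Submodule.inner_starProjection_left_eq_right, h1, h2]

theorem isUnit_one_sub_clm {K : Type*} [NormedAddCommGroup K] [InnerProductSpace ℂ K]
    [CompleteSpace K] {B : K →L[ℂ] K} (hB : ‖B‖ < 1) : IsUnit (1 - B) :=
  isUnit_one_sub_of_norm_lt_one hB

/-- With `z = (1 - B)⁻¹ y`, the quantity is `‖z‖² - Re ⟪B z, z⟫ ≥ (1 - ‖B‖) ‖z‖²`. -/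
theorem re_inner_inverse_nonneg {K : Type*} [NormedAddCommGroup K] [InnerProductSpace ℂ K]
    [CompleteSpace K] {B : K →L[ℂ] K} (hB : ‖B‖ < 1) (y : K) :
    0 ≤ (⟪y, Ring.inverse (1 - B) y⟫_ℂ).re := by
  set z := Ring.inverse (1 - B) y
  have hy : y = z - B z :=
    (DFunLike.congr_fun (Ring.mul_inverse_cancel _ (isUnit_one_sub_of_norm_lt_one hB)) y).symm
  have h1 : (⟪z, z⟫_ℂ).re = ‖z‖ ^ 2 := inner_self_eq_norm_sq (𝕜 := ℂ) z
  have h2 : (⟪B z, z⟫_ℂ).re ≤ ‖B z‖ * ‖z‖ := re_inner_le_norm (𝕜 := ℂ) _ _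
  have h3 := B.le_opNorm z
  rw [hy, inner_sub_left, Complex.sub_re, h1]
  nlinarith [norm_nonneg z, mul_le_mul_of_nonneg_right h3 (norm_nonneg z),
    mul_le_mul_of_nonneg_right hB.le (mul_self_nonneg ‖z‖)]

end Blocks

/-! ### Positivity of the two factors. -/

section SchurComplement

variable {K L : Type*} [NormedAddCommGroup K] [InnerProductSpace ℂ K] [CompleteSpace K]
  [NormedAddCommGroup L] [InnerProductSpace ℂ L] [CompleteSpace L]
  {M : Type*} [NormedAddCommGroup M] [InnerProductSpace ℂ M] [CompleteSpace M]

theorem re_inner_le_of_norm_le {T : K →L[ℂ] K} {q : ℝ} (hT : ‖T‖ ≤ q) (x : K) :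
    (⟪x, T x⟫_ℂ).re ≤ q * ‖x‖ ^ 2 := by
  have h1 : (⟪x, T x⟫_ℂ).re ≤ ‖x‖ * ‖T x‖ := re_inner_le_norm (𝕜 := ℂ) x (T x)
  have h2 := T.le_of_opNorm_le hT x
  nlinarith [norm_nonneg x]

theorem fredholmDet_one_sub_pos_of_norm_lt_one {B : K →L[ℂ] K} {C D : K →L[ℂ] M} (hB : IsSelfAdjoint B)
    (hC : HS C) (hD : HS D) (hCD : B = C.adjoint ∘L D) (hnorm : ‖B‖ < 1) :
    IsTraceClass B ∧ (fredholmDet (1 - B)).im = 0 ∧ 0 < (fredholmDet (1 - B)).re := by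
  refine ⟨?_, fredholmDet_one_sub_pos hB hC hD hCD hnorm (re_inner_le_of_norm_le le_rfl)⟩
  rw [hCD] at hB ⊢
  exact isTraceClass_of_hs hC hD hB

/-- The subtracted term `A₁₂⋆ R A₁₂` has nonnegative form, so `q = ‖A₂₂‖` bounds the form of `B`
from above. This one-sided bound is enough, and no bound on `‖B‖` is needed. -/
theorem fredholmDet_schurComplement_pos {A₁₁ : K →L[ℂ] K} {A₁₂ : L →L[ℂ] K} {A₂₁ : K →L[ℂ] L}
    {A₂₂ : L →L[ℂ] L} {C D : L →L[ℂ] M} (h₁₁ : IsSelfAdjoint A₁₁) (n₁₁ : ‖A₁₁‖ < 1) (h₂₂ : IsSelfAdjoint A₂₂)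
    (n₂₂ : ‖A₂₂‖ < 1) (h₂₁ : A₂₁ = -A₁₂.adjoint) (h₁₂ : HS A₁₂) (hC : HS C) (hD : HS D)
    (hCD : A₂₂ = C.adjoint ∘L D) :
    IsTraceClass (A₂₂ + A₂₁ ∘L Ring.inverse (1 - A₁₁) ∘L A₁₂) ∧
      (fredholmDet (1 - A₂₂ - A₂₁ ∘L Ring.inverse (1 - A₁₁) ∘L A₁₂)).im = 0 ∧
      0 < (fredholmDet (1 - A₂₂ - A₂₁ ∘L Ring.inverse (1 - A₁₁) ∘L A₁₂)).re := by
  set R := Ring.inverse (1 - A₁₁) with hR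
  have hRsa : IsSelfAdjoint R := by
    have h : IsSelfAdjoint (1 - A₁₁) := (IsSelfAdjoint.one _).sub h₁₁
    rw [isSelfAdjoint_iff, hR, ← Ring.inverse_star, h.star_eq]
  set B := A₂₂ + A₂₁ ∘L R ∘L A₁₂ with hB
  have hsub : 1 - A₂₂ - A₂₁ ∘L R ∘L A₁₂ = 1 - B := sub_sub _ _ _
  rw [hsub]
  have hBneg : B = A₂₂ - A₁₂.adjoint ∘L R ∘L A₁₂ := by
    rw [hB, h₂₁, ContinuousLinearMap.neg_comp, sub_eq_add_neg]
  have hBsa : IsSelfAdjoint B := by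
    rw [hBneg]
    exact h₂₂.sub (hRsa.adjoint_conj A₁₂)
  have hCDB : B = (pairOp C A₂₁.adjoint).adjoint ∘L pairOp D (R ∘L A₁₂) := by
    rw [adjoint_pairOp_comp, ContinuousLinearMap.adjoint_adjoint, ← hCD]
  have h₂₁' : HS A₂₁.adjoint := by
    rw [h₂₁]
    exact h₁₂.adjoint.neg.adjoint
  have hCB := hC.pairOp h₂₁'
  have hDB := hD.pairOp (h₁₂.comp_left R)
  refine ⟨?_, fredholmDet_one_sub_pos hBsa hCB hDB hCDB n₂₂ fun x => ?_⟩
  · rw [hCDB] at hBsa ⊢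
    exact isTraceClass_of_hs hCB hDB hBsa
  · have h1 := re_inner_le_of_norm_le (T := A₂₂) le_rfl x
    have h2 := re_inner_inverse_nonneg n₁₁ (A₁₂ x)
    rw [hBneg, sub_apply, inner_sub_right, Complex.sub_re, ContinuousLinearMap.comp_apply,
      ContinuousLinearMap.adjoint_inner_right, ContinuousLinearMap.comp_apply]
    linarith

end SchurComplement

/-! ### The product formula and the conclusion. -/

section ExtDet

variable {H : Type*} [NormedAddCommGroup H] [InnerProductSpace ℂ H] [CompleteSpace H]
  {H₁ : Submodule ℂ H} [CompleteSpace H₁] {A C D : H →L[ℂ] H} {ι κ : Type*}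

theorem tendsto_det_splitBasis [DecidableEq ι] [DecidableEq κ] (e : HilbertBasis ι ℂ H₁)
    (f : HilbertBasis κ ℂ H₁ᗮ) (hA : HS A) (hC : HS C) (hD : HS D)
    (hCD : evenPart H₁ A = C.adjoint ∘L D) :
    Tendsto (fun p : Finset ι × Finset κ =>
      (Matrix.fromBlocks (1 - finSection (opMat e (block H₁ H₁ A)) p.1)
        (-rectMat e f (block H₁ H₁ᗮ A) p.1 p.2) (-rectMat f e (block H₁ᗮ H₁ A) p.2 p.1)
        (1 - finSection (opMat f (block H₁ᗮ H₁ᗮ A)) p.2)).det) atTop (𝓝 (extDet H₁ (1 - A))) := by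
  have hdiag : ∀ i, ⟪splitBasis H₁ e f i, evenPart H₁ A (splitBasis H₁ e f i)⟫_ℂ =
      ⟪splitBasis H₁ e f i, A (splitBasis H₁ e f i)⟫_ℂ := by
    rintro (i | i)
    · rw [splitBasis_inl, inner_evenPart_left, starProjection_coe_self]
    · rw [splitBasis_inr, inner_evenPart_right, starProjection_coe_self]
  have h := (tendsto_det_extDet (splitBasis H₁ e f) H₁ hA hC hD hCD hdiag).comp
    (tendsto_disjSum (ι := ι) (κ := κ))
  refine h.congr fun p => ?_
  rw [Function.comp_apply, det_one_sub_finSection_disjSum]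

/-- The same net of block determinants converges to both sides. -/
theorem extDet_one_sub_eq_mul (hA : HS A) (hC : HS C) (hD : HS D)
    (hCD : evenPart H₁ A = C.adjoint ∘L D) (hodd : HS (oddPart H₁ A)) (hnorm : ‖A‖ < 1) :
    extDet H₁ (1 - A) = fredholmDet (1 - block H₁ H₁ A) *
      fredholmDet (1 - block H₁ᗮ H₁ᗮ A -
        block H₁ᗮ H₁ A ∘L Ring.inverse (1 - block H₁ H₁ A) ∘L block H₁ H₁ᗮ A) := by
  classical
  have h₁ : block H₁ H₁ A = (C ∘L H₁.subtypeL).adjoint ∘L (D ∘L H₁.subtypeL) := by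
    rw [← block_evenPart_left, hCD, block_adjoint_comp]
  have h₂ : block H₁ᗮ H₁ᗮ A = (C ∘L H₁ᗮ.subtypeL).adjoint ∘L (D ∘L H₁ᗮ.subtypeL) := by
    rw [← block_evenPart_right, hCD, block_adjoint_comp]
  have h₁₂ : HS (block H₁ H₁ᗮ A) := by rw [← block_oddPart_left]; exact hodd.block _ _
  have h₂₁ : HS (block H₁ᗮ H₁ A) := by rw [← block_oddPart_right]; exact hodd.block _ _
  exact tendsto_nhds_unique (tendsto_det_splitBasis (onb H₁) (onb H₁ᗮ) hA hC hD hCD)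
    (tendsto_det_fromBlocks_finSection (onb H₁) (onb H₁ᗮ)
      ((norm_block_le _ _ A).trans_lt hnorm) (hC.comp_right _) (hD.comp_right _) h₁
      (hC.comp_right _) (hD.comp_right _) h₂ h₁₂ h₂₁)

theorem extDet_one_sub_pos (hJ : IsJSelfAdjoint H₁ A) (hA : IsL12 H₁ A) (hnorm : ‖A‖ < 1) :
    IsUnit (1 - block H₁ H₁ A) ∧ IsTraceClass (block H₁ H₁ A) ∧
    IsTraceClass (block H₁ᗮ H₁ᗮ A +
      block H₁ᗮ H₁ A ∘L Ring.inverse (1 - block H₁ H₁ A) ∘L block H₁ H₁ᗮ A) ∧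
    extDet H₁ (1 - A) = fredholmDet (1 - block H₁ H₁ A) *
      fredholmDet (1 - block H₁ᗮ H₁ᗮ A -
        block H₁ᗮ H₁ A ∘L Ring.inverse (1 - block H₁ H₁ A) ∘L block H₁ H₁ᗮ A) ∧
    (extDet H₁ (1 - A)).im = 0 ∧ 0 < (extDet H₁ (1 - A)).re := by
  obtain ⟨C, D, hC, hD, hCD⟩ := hA.1.exists_hs hJ.evenPart
  have hodd : HS (oddPart H₁ A) := hA.2
  have hAHS : HS A := by
    rw [← evenPart_add_oddPart (H₁ := H₁) (A := A), hCD]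
    exact (hD.comp_left _).add hodd
  have hdet := extDet_one_sub_eq_mul hAHS hC hD hCD hodd hnorm
  have h₁ : block H₁ H₁ A = (C ∘L H₁.subtypeL).adjoint ∘L (D ∘L H₁.subtypeL) := by
    rw [← block_evenPart_left, hCD, block_adjoint_comp]
  have h₂ : block H₁ᗮ H₁ᗮ A = (C ∘L H₁ᗮ.subtypeL).adjoint ∘L (D ∘L H₁ᗮ.subtypeL) := by
    rw [← block_evenPart_right, hCD, block_adjoint_comp]
  have h₁₂ : HS (block H₁ H₁ᗮ A) := by rw [← block_oddPart_left]; exact hodd.block _ _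
  have n₁ : ‖block H₁ H₁ A‖ < 1 := (norm_block_le _ _ A).trans_lt hnorm
  have n₂ : ‖block H₁ᗮ H₁ᗮ A‖ < 1 := (norm_block_le _ _ A).trans_lt hnorm
  obtain ⟨t₁, i₁, p₁⟩ := fredholmDet_one_sub_pos_of_norm_lt_one hJ.block_left
    (hC.comp_right _) (hD.comp_right _) h₁ n₁
  obtain ⟨t₂, i₂, p₂⟩ := fredholmDet_schurComplement_pos hJ.block_left n₁ hJ.block_right n₂
    hJ.block_offDiag h₁₂ (hC.comp_right _) (hD.comp_right _) h₂
  refine ⟨isUnit_one_sub_clm n₁, t₁, t₂, hdet, ?_, ?_⟩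
  · rw [hdet, Complex.mul_im, i₁, i₂, mul_zero, zero_mul, add_zero]
  · rw [hdet, Complex.mul_re, i₁, i₂, mul_zero, sub_zero]
    exact mul_pos p₁ p₂

end ExtDet

end ExtFredholm

end

theorem mainTheorem7 {H : Type*} [NormedAddCommGroup H] [InnerProductSpace ℂ H] [CompleteSpace H]
    [TopologicalSpace.SeparableSpace H] (H₁ : Submodule ℂ H) [CompleteSpace H₁]
    (A : H →L[ℂ] H) (hJ : ExtFredholm.IsJSelfAdjoint H₁ A) (hA : ExtFredholm.IsL12 H₁ A)
    (hnorm : ‖A‖ < 1)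
    (A₁₁ : H₁ →L[ℂ] H₁) (hA₁₁ : A₁₁ = ExtFredholm.block H₁ H₁ A)
    (A₁₂ : H₁ᗮ →L[ℂ] H₁) (hA₁₂ : A₁₂ = ExtFredholm.block H₁ H₁ᗮ A)
    (A₂₁ : H₁ →L[ℂ] H₁ᗮ) (hA₂₁ : A₂₁ = ExtFredholm.block H₁ᗮ H₁ A)
    (A₂₂ : H₁ᗮ →L[ℂ] H₁ᗮ) (hA₂₂ : A₂₂ = ExtFredholm.block H₁ᗮ H₁ᗮ A)
    (hpos : A₁₁.IsPositive) :
    IsUnit (1 - A₁₁) ∧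
    ExtFredholm.IsTraceClass A₁₁ ∧
    ExtFredholm.IsTraceClass (A₂₂ + A₂₁ ∘L Ring.inverse (1 - A₁₁) ∘L A₁₂) ∧
    ExtFredholm.extDet H₁ (1 - A) =
      ExtFredholm.fredholmDet (1 - A₁₁) *
        ExtFredholm.fredholmDet (1 - A₂₂ - A₂₁ ∘L Ring.inverse (1 - A₁₁) ∘L A₁₂) ∧
    (ExtFredholm.extDet H₁ (1 - A)).im = 0 ∧ 0 < (ExtFredholm.extDet H₁ (1 - A)).re := by
  subst hA₁₁ hA₁₂ hA₂₁ hA₂₂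
  exact ExtFredholm.extDet_one_sub_pos hJ hA hnorm
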